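/- **Conventions.** Write $\bar x=x^{-1}$. An edge is in the state $0$ (hole) or $1$ (particle). Partitions may have parts equal to $0$; $m_i(\lambda)$ is the number of parts of $\lambda$ equal to $i\ge 0$, and $|\lambda|$ is the sum of the parts. **Hall–Littlewood polynomials.** On basis states $|\mu\rangle=\bigotimes_{i\ge0}|m_i(\mu)\rangle_i$ let $\phi|m\rangle=(1-t^m)|m-1\rangle$ and $\phi^\dagger|m\rangle=|m+1\rangle$, and let $L(x)=\begin{pmatrix}x&x\phi^\dagger\\ \phi&1\end{pmatrix}$, with rows and columns indexed by $0,1$. Let $T_+(x)$ and $T_-(x)$ be the entries $(0,1)$ and $(1,1)$ of the ordered product $\prod_{i\ge0}L(x,\phi_i,\phi_i^\dagger)$ (matrix elements between two given states; far to the right only the entry $1$ in position $(1,1)$ is used). Put $\mathbb T(x)=T_-(\bar x)T_+(x)-t\,T_+(\bar x)T_-(x)$. The hyperoctahedral (type $BC_m$) Hall–Littlewood polynomial $K_\lambda(x_1^{\pm1},\dots,x_m^{\pm1};t)$ (boundary parameters $\gamma=\delta=0$) of a partition $\lambda$ with $m$ parts is defined by $$\prod_{i=1}^{m}(x_i-t\bar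 x_i)\,K_\lambda(x_1^{\pm1},\dots,x_m^{\pm1};t)=\langle\lambda|\,\mathbb T(x_m)\cdots\mathbb T(x_1)\,|0\rangle ,$$ where $|0\rangle$ is the state without particles. **Partition function.** For $x_1,\dots,x_{2n}$ and $z$, let $(u_1,u_2,\dots,u_{4n})=(x_1,\bar x_1,x_2,\bar x_2,\dots,x_{2n},\bar x_{2n})$. Take $4n$ lines. Line $j$ runs from its left end to the right as row $j$ (rows numbered from top to bottom), with spectral parameter $\sqrt z\,u_j$; on the diagonal it turns upwards, its state being flipped ($0\leftrightarrow1$) and its spectral parameter inverted; it then runs upwards as column $j$ (columns numbered from right to left), with spectral parameter $(\sqrt z\,u_j)^{-1}$. So, for each $j<k$, row $j$ and column $k$ cross in exactly one vertex, and there are no other vertices. The vertex of row $j$ and column $k$, with edge states (left, bottom, right, top), has the following weight, where $w=z\,u_ju_k$ is the ratio of the horizontal to the vertical spectral parameter: $$(0,0,0,0),(1,1,1,1):\ \tfrac{1-tw}{1-w};\quad (0,1,0,1):\ t;\quad (1,0,1,0):\ 1;\quad (0,1,1,0):\ \tfrac{(1-t)w}{1-w};\quad (1,0,0,1):\ \tfrac{1-t}{1-w},$$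 and weight $0$ for all other states. All top ends of the columns are in the state $0$. The left ends of the rows $2i-1$ and $2i$ are joined by a U-turn, of weight $1$ if their states are $(0,1)$, weight $-t$ if they are $(1,0)$, and weight $0$ otherwise. Let $\mathcal Z_{\rm UO}(x_1^{\pm1},\dots,x_{2n}^{\pm1};t;z)$ be the sum over all assignments of states to the edges of the product of all vertex and U-turn weights. **Theorem (reflecting Littlewood identity).** Let $n\ge0$, let $t,z\in\mathbb C$, and let $x_1,\dots,x_{2n}\in\mathbb C$ be nonzero with $x_j\ne t\bar x_j$ and $|z|\,|x_j|^{2}<1$, $|z|\,|x_j|^{-2}<1$ for all $j$. Then $$\prod_{j=1}^{2n}(x_j-t\bar x_j)\times\sum_{\lambda:\ m_i(\lambda)\in2\mathbb N}z^{\,n+|\lambda|/2}\prod_{i=0}^{\infty}\prod_{j=1}^{m_i(\lambda)/2}(1-t^{2j-1})\,K_\lambda(x_1^{\pm1},\dots,x_{2n}^{\pm1};t)=\mathcal Z_{\rm UO}(x_1^{\pm1},\dots,x_{2n}^{\pm1};t;z),$$ where the sum, over all partitions $\lambda$ with exactly $2n$ parts (zeros included) all of whose multiplicities $m_i(\lambda)$,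 $i\ge0$, are even, converges absolutely. -/

import Mathlib

/-!
Edge states are elements of `Fin 2`: `0` is a hole and `1` is a particle.
-/

noncomputable section

namespace ReflectingLittlewood

/-! ### The t-boson model and the hyperoctahedral Hall-Littlewood polynomials -/

/-- A partition, parts equal to zero being allowed, is recorded by its multiplicities: `lam i` is
the number `m_i` of parts of size `i`, for `i = 0, 1, 2, …`.  This is also the basis state
`|m_0⟩ ⊗ |m_1⟩ ⊗ |m_2⟩ ⊗ ⋯` of the bosonic space. -/
abbrev PartState := ℕ →₀ ℕ

/-- The number of parts of a partition (parts equal to zero included). -/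
def numParts (lam : PartState) : ℕ := lam.sum fun _ k => k

/-- The weight `|λ|`, the sum of the parts. -/
def weight (lam : PartState) : ℕ := lam.sum fun i k => i * k

/-- A basis state of the lattice with two additional boundary sites, `-2` and `-1`: the
occupation numbers of site `-2`, of site `-1` and of the sites `0, 1, 2, …`. -/
abbrev LatticeState := ℕ × ℕ × PartState

/-- The matrix elements `⟨m'| · |m⟩` of the entries of the `L` matrix
`(x, x φ†; φ, 1)`, where `φ|m⟩ = (1 - t^m)|m-1⟩` and `φ†|m⟩ = |m+1⟩`.  The row index is the state of
the left edge, the column index that of the right edge; `m` is the occupation number at the top of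
the tile and `m'` the one at its bottom. -/
def lMatrix (t x : ℂ) (m' m : ℕ) : Matrix (Fin 2) (Fin 2) ℂ :=
  !![if m' = m then x else 0, if m' = m + 1 then x else 0;
     if m' + 1 = m then 1 - t ^ m else 0, if m' = m then 1 else 0]

/-- The matrix elements `⟨m'| · |m⟩` of the entries of the boundary `B` matrix
`(t^N, g x φ† t^N; φ, 1 - g x t^N)`, with `N` the number operator and boundary parameter `g`. -/
def bMatrix (t g x : ℂ) (m' m : ℕ) : Matrix (Fin 2) (Fin 2) ℂ :=
  !![if m' = m then t ^ m else 0, if m' = m + 1 then g * x * t ^ m else 0;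
     if m' + 1 = m then 1 - t ^ m else 0, if m' = m then 1 - g * x * t ^ m else 0]

/-- A site from which on both states are empty. -/
def cutoff (lam mu : PartState) : ℕ := (lam.support ∪ mu.support).sup id + 1

/-- The matrix element between the states `mu` (top) and `lam` (bottom) of one dark row with
spectral parameter `x`, boundary sites included: the state of the left edge is `a`, and there are
only particles on the horizontal edges far to the right.  From the site `cutoff` on, the `L`
matrices are `diag(x, 1)` and do not change the entry in the particle column, so that the infinite
product may be stopped there. -/
def rowElement (t γ δ x : ℂ) (a : Fin 2) (lam mu : LatticeState) : ℂ :=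
  (bMatrix t γ x lam.1 mu.1 * bMatrix t δ x lam.2.1 mu.2.1 *
    ((List.range (cutoff lam.2.2 mu.2.2)).map
      fun i => lMatrix t x (lam.2.2 i) (mu.2.2 i)).prod) a 1

/-- The boundary covector (U-turn): weight `1` for a hole on the first line and a particle on the
second one, `-t` for a particle on the first line and a hole on the second one. -/
def uTurn (t : ℂ) : Fin 2 → Fin 2 → ℂ
  | 0, 1 => 1
  | 1, 0 => -t
  | _, _ => 0

/-- The matrix element `⟨lam| 𝕋₋₋(x; γ, δ) |mu⟩` of the double-row transfer matrix: an upper row with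
parameter `x`, a lower row with parameter `x⁻¹`, joined by a U-turn on the left.  Only finitely many
intermediate states `nu` contribute. -/
def doubleRowElement (t γ δ x : ℂ) (lam mu : LatticeState) : ℂ :=
  ∑ᶠ nu : LatticeState, ∑ a : Fin 2, ∑ b : Fin 2,
    uTurn t a b * rowElement t γ δ x⁻¹ b lam nu * rowElement t γ δ x a nu mu

/-- The matrix element `⟨lam| 𝕋₋₋(x_m; γ, δ) ⋯ 𝕋₋₋(x_1; γ, δ) |0⟩`, with `|0⟩` the empty
state.  Only finitely many intermediate states contribute. -/
def latticeElement (t γ δ : ℂ) : (m : ℕ) → (Fin m → ℂ) → LatticeState → ℂ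
  | 0, _, lam => if lam = (0, 0, 0) then 1 else 0
  | m + 1, x, lam => ∑ᶠ mu : LatticeState,
      doubleRowElement t γ δ (x (Fin.last m)) lam mu *
        latticeElement t γ δ m (fun i => x i.castSucc) mu

/-- The hyperoctahedral (type `BC_m`) Hall-Littlewood polynomial
`K_λ(x_1^{±1}, …, x_m^{±1}; t; γ, δ)`, for nonzero `x_i` with `x_i ≠ t x_i⁻¹`. -/
def hallLittlewoodK {m : ℕ} (t γ δ : ℂ) (x : Fin m → ℂ) (lam : PartState) : ℂ :=
  latticeElement t γ δ m x (0, 0, lam) / ∏ i, (x i - t * (x i)⁻¹)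

/-- The partitions with exactly `m` parts (parts equal to zero included), all of whose
multiplicities `m_i`, `i ≥ 0`, are even. -/
abbrev EvenPartition (m : ℕ) := {lam : PartState // numParts lam = m ∧ ∀ i, Even (lam i)}

/-- The coefficient `∏_{i ≥ 0} ∏_{j = 1}^{m_i / 2} (1 - t^{2j-1})`. -/
def evenCoeff (t : ℂ) (lam : PartState) : ℂ :=
  lam.prod fun _ k => ∏ j ∈ Finset.Icc 1 (k / 2), (1 - t ^ (2 * j - 1))

/-! ### The six-vertex partition function with U-turn boundaries and off-diagonal symmetry

There are `N = 2m` lines.  Line `j` starts on the left as a horizontal row, runs to the diagonal, is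
there turned upwards by a spin-flip, and leaves through the top as a vertical column.  Hence, for
`j < k`, row `j` (rows are numbered from top to bottom) crosses column `k` (columns are numbered
from right to left) in the vertex `(j, k)`, and there are no other vertices:
from left to right, row `j` meets the columns `N - 1, …, j + 1`; from top to bottom, column `k` meets
the rows `0, …, k - 1`. -/

/-- The Boltzmann weights of the six-vertex model: the entries of the `R` matrix whose argument `w`
is the ratio (parameter of the horizontal line) / (parameter of the vertical line). -/
def rWeight (t w : ℂ) (left bottom right top : Fin 2) : ℂ :=
  match left, bottom, right, top with
  | 0, 0, 0, 0 => (1 - t * w) / (1 - w)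
  | 1, 1, 1, 1 => (1 - t * w) / (1 - w)
  | 0, 1, 0, 1 => t
  | 1, 0, 1, 0 => 1
  | 0, 1, 1, 0 => (1 - t) * w / (1 - w)
  | 1, 0, 0, 1 => (1 - t) / (1 - w)
  | _, _, _, _ => 0

/-- The vertices: row `p.1` crosses column `p.2`. -/
abbrev Vertex (N : ℕ) := {p : Fin N × Fin N // p.1 < p.2}

/-- Labels of the edges, both horizontal and vertical.  For `j < k`, the horizontal edge `(j, k)` is
the one to the left of the vertex `(j, k)`, and the vertical edge `(j, k)` is the one above it.  The
horizontal edge `(k, k)` is the last edge of row `k`, and the vertical edge `(k, k)` is the lowest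
edge of column `k`; these two meet at the diagonal. -/
abbrev Edge (N : ℕ) := {p : Fin N × Fin N // p.1 ≤ p.2}

variable {N : ℕ}

/-- The label of the horizontal edge to the left of a vertex, and of the vertical edge above it. -/
def Vertex.here (p : Vertex N) : Edge N := ⟨p.1, p.2.le⟩

/-- The label of the horizontal edge to the right of a vertex. -/
def Vertex.toRight (p : Vertex N) : Edge N :=
  ⟨(p.1.1, ⟨(p.1.2 : ℕ) - 1, by omega⟩), Fin.le_def.2 (Nat.le_sub_one_of_lt (Fin.lt_def.1 p.2))⟩

/-- The label of the vertical edge below a vertex. -/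
def Vertex.below (p : Vertex N) : Edge N :=
  ⟨(⟨(p.1.1 : ℕ) + 1, lt_of_le_of_lt (Nat.succ_le_of_lt (Fin.lt_def.1 p.2)) p.1.2.isLt⟩, p.1.2),
    Fin.le_def.2 (Nat.succ_le_of_lt (Fin.lt_def.1 p.2))⟩

/-- The label of the last horizontal edge of row `k` and of the lowest vertical edge of
column `k`. -/
def diagonalEdge (k : Fin N) : Edge N := ⟨(k, k), le_rfl⟩

/-- The label of the leftmost horizontal edge of row `j`. -/
def leftmostEdge (j : Fin N) : Edge N :=
  ⟨(j, ⟨N - 1, Nat.sub_one_lt_of_lt j.isLt⟩), Fin.le_def.2 (Nat.le_sub_one_of_lt j.isLt)⟩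

/-- The label of the uppermost vertical edge of column `k`. -/
def uppermostEdge (k : Fin N) : Edge N :=
  ⟨(⟨0, Nat.zero_lt_of_lt k.isLt⟩, k), Fin.le_def.2 (Nat.zero_le _)⟩

/-- The parameters `x_1, x_1⁻¹, x_2, x_2⁻¹, …, x_m, x_m⁻¹` of the lines. -/
def lineParameter {m : ℕ} (x : Fin m → ℂ) (j : Fin (2 * m)) : ℂ :=
  if (j : ℕ) % 2 = 0 then x ⟨(j : ℕ) / 2, by omega⟩ else (x ⟨(j : ℕ) / 2, by omega⟩)⁻¹

/-- The partition function: the sum over all states `h`, `v` of the horizontal and vertical edges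
such that there are holes at the top and the state is flipped at the diagonal, of the product of the
weights of the U-turns, which join the left ends of the rows of `x_i` and `x_i⁻¹`, and of all
vertices.  With `u` the parameters of the lines, row `j` carries the spectral parameter `√z u_j`, and
column `k` the inverted one `(√z u_k)⁻¹`; the ratio is `z u_j u_k`. -/
def partitionFunctionUO {m : ℕ} (t z : ℂ) (x : Fin m → ℂ) : ℂ :=
  ∑ h : Edge (2 * m) → Fin 2, ∑ v : Edge (2 * m) → Fin 2,
    if (∀ k, v (uppermostEdge k) = 0) ∧ (∀ k, v (diagonalEdge k) = (h (diagonalEdge k)).rev) then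
      (∏ i : Fin m, uTurn t (h (leftmostEdge ⟨2 * (i : ℕ), by omega⟩))
          (h (leftmostEdge ⟨2 * (i : ℕ) + 1, by omega⟩))) *
        ∏ p : Vertex (2 * m),
          rWeight t (z * lineParameter x p.1.1 * lineParameter x p.1.2)
            (h p.here) (v p.below) (h p.toRight) (v p.here)
    else 0

end ReflectingLittlewood

end

noncomputable section

namespace ReflectingLittlewood

open Filter Topology

/-! ### Boson operators -/

/-! Write z = q² and give the rows the parameters q·u_j, all of modulus less than 1. Cut the bosonic
lattice off after M sites and pair the state built by the rows with `evenCovector`, whose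
coefficients are those of the sum. Three facts turn this pairing into the six-vertex sum.

Reflection: the covector does not distinguish φ from φ† at any site, so next to it the outermost row
may be replaced by a dual row, in which φ and φ† are exchanged (`evenCovector_monodromy`). Exchange:
a dual row passes through an ordinary row at the cost of one six-vertex weight, by a Yang–Baxter
relation that is checked at a single site (`exchange_site`, `dualMonodromy_mul_monodromy`). Vacuum:
a dual row that reaches the vacuum disappears or gives zero (`dualMonodromy_vacuum`). So a reflected
row becomes a column, whose vertices are the exchanges it undergoes, and the lines are removed one
by one. The partition function obeys the same recursion (`gridSum_succ`).

For finite M the exchange has an extra term, in which both lines leave on the right as holes. It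
disappears as M → ∞, since a hole costs a factor of its parameter at every site. Weighted ℓ¹
estimates (`monodromy_basis_bound`, `dualMonodromy_basis_bound`) make this uniform on states with
boundedly many particles, for every t.

Finally, homogeneity in q produces the powers of z (`doubleRowState_homogeneous`). The coefficient
of λ in the truncated state is exact if all parts are less than M and zero otherwise, so the uniform
norm bounds give absolute convergence, and dominated convergence identifies the limit with the
series. -/

/-- The vector space spanned by the basis states. -/
abbrev Fock := PartState →₀ ℂ

/-- The annihilation operator `φ` at a site. -/
def annihilation (t : ℂ) (i : ℕ) : Module.End ℂ Fock :=
  Finsupp.linearCombination ℂ fun mu : PartState =>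
    (1 - t ^ mu i) • (Finsupp.single (mu - Finsupp.single i 1) 1 : Fock)

/-- The creation operator `φ†` at a site. -/
def creation (i : ℕ) : Module.End ℂ Fock :=
  Finsupp.linearCombination ℂ fun mu : PartState =>
    (Finsupp.single (mu + Finsupp.single i 1) 1 : Fock)

lemma annihilation_single (t : ℂ) (i : ℕ) (mu : PartState) :
    annihilation t i (Finsupp.single mu 1) =
      (1 - t ^ mu i) • Finsupp.single (mu - Finsupp.single i 1) 1 := by
  simp [annihilation]

lemma creation_single (i : ℕ) (mu : PartState) :
    creation i (Finsupp.single mu 1) = Finsupp.single (mu + Finsupp.single i 1) 1 := by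
  simp [creation]

lemma end_ext {A B : Module.End ℂ Fock}
    (h : ∀ mu : PartState, A (Finsupp.single mu 1) = B (Finsupp.single mu 1)) : A = B := by
  refine Finsupp.lhom_ext' fun mu => LinearMap.ext_ring ?_
  simpa using h mu

/-- This t-boson relation is the only commutation relation at a single site behind the exchange
relation. At an empty site the truncated subtraction does no harm, its coefficient `1 - t ^ 0` being
zero. -/
lemma annihilation_mul_creation (t : ℂ) (i : ℕ) :
    annihilation t i * creation i = (1 - t) • 1 + t • (creation i * annihilation t i) := by
  refine end_ext fun mu => ?_
  simp only [Module.End.mul_apply, LinearMap.add_apply, LinearMap.smul_apply, Module.End.one_apply,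
    annihilation_single, creation_single, map_smul, Finsupp.add_apply, Finsupp.single_eq_same,
    add_tsub_cancel_right]
  by_cases hm : mu i = 0
  · simp [hm]
  · have hsub : mu - Finsupp.single i 1 + Finsupp.single i 1 = mu :=
      tsub_add_cancel_of_le (by simpa [Finsupp.single_le_iff] using Nat.one_le_iff_ne_zero.2 hm)
    rw [hsub, smul_smul, ← add_smul]
    congr 1
    ring

lemma commute_creation (i j : ℕ) : Commute (creation i) (creation j) := by
  refine end_ext fun mu => ?_
  simp only [Module.End.mul_apply, creation_single, add_right_comm]

lemma commute_annihilation_creation (t : ℂ) {i j : ℕ} (h : i ≠ j) :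
    Commute (annihilation t i) (creation j) := by
  refine end_ext fun mu => ?_
  have : mu + Finsupp.single j 1 - Finsupp.single i 1 =
      mu - Finsupp.single i 1 + Finsupp.single j 1 := by
    ext k
    by_cases hk : k = i
    · subst hk; simp [h]
    · simp [Ne.symm hk]
  simp only [Module.End.mul_apply, annihilation_single, creation_single, map_smul, this]
  simp [h]

lemma commute_annihilation (t : ℂ) {i j : ℕ} (h : i ≠ j) :
    Commute (annihilation t i) (annihilation t j) := by
  refine end_ext fun mu => ?_
  simp only [Module.End.mul_apply, annihilation_single, map_smul, smul_smul]
  rw [tsub_right_comm]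
  congr 1
  simp [h, h.symm, mul_comm]

/-! ### `L` matrices and monodromy matrices -/

/-- The `L` matrix at a site. -/
def siteL (t x : ℂ) (i : ℕ) : Matrix (Fin 2) (Fin 2) (Module.End ℂ Fock) :=
  !![x • 1, x • creation i; annihilation t i, 1]

/-- The `L` matrix at a site with creation and annihilation exchanged. -/
def siteDualL (t x : ℂ) (i : ℕ) : Matrix (Fin 2) (Fin 2) (Module.End ℂ Fock) :=
  !![x • 1, x • annihilation t i; creation i, 1]

/-- The ordered product of the `L` matrices at the sites `0, …, M - 1`. -/
def monodromy (t x : ℂ) : ℕ → Matrix (Fin 2) (Fin 2) (Module.End ℂ Fock)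
  | 0 => 1
  | M + 1 => monodromy t x M * siteL t x M

/-- The ordered product of the dual `L` matrices at the sites `0, …, M - 1`. -/
def dualMonodromy (t x : ℂ) : ℕ → Matrix (Fin 2) (Fin 2) (Module.End ℂ Fock)
  | 0 => 1
  | M + 1 => dualMonodromy t x M * siteDualL t x M

/-- The operators which commute with the boson operators at the site `j`. -/
def CommutesAt (t : ℂ) (j : ℕ) (A : Module.End ℂ Fock) : Prop :=
  Commute A (annihilation t j) ∧ Commute A (creation j)

lemma CommutesAt.add {t : ℂ} {j : ℕ} {A B : Module.End ℂ Fock} (hA : CommutesAt t j A)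
    (hB : CommutesAt t j B) : CommutesAt t j (A + B) :=
  ⟨hA.1.add_left hB.1, hA.2.add_left hB.2⟩

lemma CommutesAt.mul {t : ℂ} {j : ℕ} {A B : Module.End ℂ Fock} (hA : CommutesAt t j A)
    (hB : CommutesAt t j B) : CommutesAt t j (A * B) :=
  ⟨hA.1.mul_left hB.1, hA.2.mul_left hB.2⟩

lemma commutesAt_siteL (t x : ℂ) {i j : ℕ} (h : i ≠ j) (a b : Fin 2) :
    CommutesAt t j (siteL t x i a b) := by
  fin_cases a <;> fin_cases b
  · show CommutesAt t j (x • 1)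
    exact ⟨(Commute.one_left _).smul_left _, (Commute.one_left _).smul_left _⟩
  · show CommutesAt t j (x • creation i)
    exact ⟨(commute_annihilation_creation t h.symm).symm.smul_left _,
      (commute_creation _ _).smul_left _⟩
  · show CommutesAt t j (annihilation t i)
    exact ⟨commute_annihilation t h, commute_annihilation_creation t h⟩
  · show CommutesAt t j (1)
    exact ⟨Commute.one_left _, Commute.one_left _⟩

lemma commutesAt_siteDualL (t x : ℂ) {i j : ℕ} (h : i ≠ j) (a b : Fin 2) :
    CommutesAt t j (siteDualL t x i a b) := by
  fin_cases a <;> fin_cases b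
  · show CommutesAt t j (x • 1)
    exact ⟨(Commute.one_left _).smul_left _, (Commute.one_left _).smul_left _⟩
  · show CommutesAt t j (x • annihilation t i)
    exact ⟨(commute_annihilation t h).smul_left _,
      (commute_annihilation_creation t h).smul_left _⟩
  · show CommutesAt t j (creation i)
    exact ⟨(commute_annihilation_creation t h.symm).symm, commute_creation _ _⟩
  · show CommutesAt t j (1)
    exact ⟨Commute.one_left _, Commute.one_left _⟩

lemma commutesAt_one (t : ℂ) (j : ℕ) (a b : Fin 2) :
    CommutesAt t j ((1 : Matrix (Fin 2) (Fin 2) (Module.End ℂ Fock)) a b) := by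
  fin_cases a <;> fin_cases b <;> simp [CommutesAt]

lemma commutesAt_monodromy (t x : ℂ) {M j : ℕ} (h : M ≤ j) (a b : Fin 2) :
    CommutesAt t j (monodromy t x M a b) := by
  induction M generalizing a b with
  | zero => exact commutesAt_one t j a b
  | succ M ih =>
    rw [monodromy, Matrix.mul_apply, Fin.sum_univ_two]
    exact ((ih (by omega) _ _).mul (commutesAt_siteL t x (by omega) _ _)).add
      ((ih (by omega) _ _).mul (commutesAt_siteL t x (by omega) _ _))

lemma commutesAt_dualMonodromy (t x : ℂ) {M j : ℕ} (h : M ≤ j) (a b : Fin 2) :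
    CommutesAt t j (dualMonodromy t x M a b) := by
  induction M generalizing a b with
  | zero => exact commutesAt_one t j a b
  | succ M ih =>
    rw [dualMonodromy, Matrix.mul_apply, Fin.sum_univ_two]
    exact ((ih (by omega) _ _).mul (commutesAt_siteDualL t x (by omega) _ _)).add
      ((ih (by omega) _ _).mul (commutesAt_siteDualL t x (by omega) _ _))

lemma CommutesAt.siteL {t : ℂ} {j : ℕ} {A : Module.End ℂ Fock} (hA : CommutesAt t j A)
    (x : ℂ) (a b : Fin 2) : Commute A (siteL t x j a b) := by
  fin_cases a <;> fin_cases b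
  · show Commute A (x • 1)
    exact (Commute.one_right _).smul_right _
  · show Commute A (x • creation j)
    exact hA.2.smul_right _
  · show Commute A (annihilation t j)
    exact hA.1
  · show Commute A (1)
    exact Commute.one_right _

lemma CommutesAt.siteDualL {t : ℂ} {j : ℕ} {A : Module.End ℂ Fock} (hA : CommutesAt t j A)
    (x : ℂ) (a b : Fin 2) : Commute A (siteDualL t x j a b) := by
  fin_cases a <;> fin_cases b
  · show Commute A (x • 1)
    exact (Commute.one_right _).smul_right _
  · show Commute A (x • annihilation t j)
    exact hA.1.smul_right _
  · show Commute A (creation j)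
    exact hA.2
  · show Commute A (1)
    exact Commute.one_right _

/-! ### The exchange relation -/

section Exchange

variable {A : Type*} [Ring A]

/-- The tensor product of two matrices over a noncommutative ring, with the entries of the first
matrix on the left. -/
def tensorLeft (X Y : Matrix (Fin 2) (Fin 2) A) : Matrix (Fin 2 × Fin 2) (Fin 2 × Fin 2) A :=
  Matrix.of fun p q => X p.1 q.1 * Y p.2 q.2

/-- The tensor product of two matrices over a noncommutative ring, with the entries of the first
matrix on the right. -/
def tensorRight (X Y : Matrix (Fin 2) (Fin 2) A) : Matrix (Fin 2 × Fin 2) (Fin 2 × Fin 2) A :=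
  Matrix.of fun p q => Y p.2 q.2 * X p.1 q.1

/-- Operators at distinct sites commute, so the two middle factors may be interchanged. This is what
lets a one-site exchange relation extend to a product of sites. -/
lemma tensorLeft_mul {X X' Y Y' : Matrix (Fin 2) (Fin 2) A}
    (h : ∀ a b c d, Commute (X' a b) (Y c d)) :
    tensorLeft (X * X') (Y * Y') = tensorLeft X Y * tensorLeft X' Y' := by
  ext p q
  simp only [tensorLeft, Matrix.of_apply, Matrix.mul_apply, Fintype.sum_prod_type,
    Finset.sum_mul_sum]
  refine Finset.sum_congr rfl fun i _ => Finset.sum_congr rfl fun j _ => ?_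
  rw [mul_assoc, mul_assoc, ← mul_assoc (X' _ _), (h _ _ _ _).eq, mul_assoc]

lemma tensorRight_mul {X X' Y Y' : Matrix (Fin 2) (Fin 2) A}
    (h : ∀ a b c d, Commute (Y' a b) (X c d)) :
    tensorRight (X * X') (Y * Y') = tensorRight X Y * tensorRight X' Y' := by
  ext p q
  simp only [tensorRight, Matrix.of_apply, Matrix.mul_apply, Fintype.sum_prod_type,
    Finset.sum_mul_sum]
  rw [Finset.sum_comm]
  refine Finset.sum_congr rfl fun i _ => Finset.sum_congr rfl fun j _ => ?_
  rw [mul_assoc, mul_assoc, ← mul_assoc (Y' _ _), (h _ _ _ _).eq, mul_assoc]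

end Exchange

/-- The crossing matrix of a flipped line (first factor) with a line (second factor). -/
def crossing (t w : ℂ) : Matrix (Fin 2 × Fin 2) (Fin 2 × Fin 2) ℂ :=
  Matrix.of fun p q => rWeight t w p.2 p.1.rev q.2 q.1.rev

/-- The crossing matrix with entries regarded as operators. -/
def crossingOp (t w : ℂ) : Matrix (Fin 2 × Fin 2) (Fin 2 × Fin 2) (Module.End ℂ Fock) :=
  (crossing t w).map (algebraMap ℂ _)

/-- The local Yang–Baxter relation: each of the sixteen entries becomes, once φφ† is reordered, an
identity between rational functions. The particle-hole flip in `crossing` is what becomes the spin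
flip on the diagonal. -/
lemma exchange_site (t : ℂ) {x y : ℂ} (h : y * x ≠ 1) (i : ℕ) :
    tensorLeft (siteDualL t y i) (siteL t x i) * crossingOp t (y * x) =
      crossingOp t (y * x) * tensorRight (siteDualL t y i) (siteL t x i) := by
  have h1 : 1 - y * x ≠ 0 := sub_ne_zero.2 h.symm
  have h2 : 1 - x * y ≠ 0 := by rwa [mul_comm x]
  have hcr := annihilation_mul_creation t i
  ext1 ⟨a, b⟩ ⟨c, d⟩
  simp only [Matrix.mul_apply, Fintype.sum_prod_type, Fin.sum_univ_two, tensorLeft, tensorRight,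
    crossingOp, crossing, Matrix.of_apply, Matrix.map_apply, Algebra.algebraMap_eq_smul_one]
  fin_cases a <;> fin_cases b <;> fin_cases c <;> fin_cases d <;>
    simp [siteL, siteDualL, rWeight, smul_smul, hcr, smul_add] <;>
    (match_scalars <;> field_simp <;> ring)

lemma tensorLeft_one :
    tensorLeft (1 : Matrix (Fin 2) (Fin 2) (Module.End ℂ Fock)) 1 = 1 := by
  ext1 ⟨a, b⟩ ⟨c, d⟩
  fin_cases a <;> fin_cases b <;> fin_cases c <;> fin_cases d <;> simp [tensorLeft]

lemma tensorRight_one :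
    tensorRight (1 : Matrix (Fin 2) (Fin 2) (Module.End ℂ Fock)) 1 = 1 := by
  ext1 ⟨a, b⟩ ⟨c, d⟩
  fin_cases a <;> fin_cases b <;> fin_cases c <;> fin_cases d <;> simp [tensorRight]

lemma exchange_monodromy (t : ℂ) {x y : ℂ} (h : y * x ≠ 1) (M : ℕ) :
    tensorLeft (dualMonodromy t y M) (monodromy t x M) * crossingOp t (y * x) =
      crossingOp t (y * x) * tensorRight (dualMonodromy t y M) (monodromy t x M) := by
  induction M with
  | zero => simp only [monodromy, dualMonodromy, tensorLeft_one, tensorRight_one, one_mul, mul_one]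
  | succ M ih =>
    rw [monodromy, dualMonodromy,
      tensorLeft_mul fun a b c d => ((commutesAt_monodromy t x le_rfl c d).siteDualL y a b).symm,
      tensorRight_mul fun a b c d => ((commutesAt_dualMonodromy t y le_rfl c d).siteL x a b).symm,
      Matrix.mul_assoc, exchange_site t h, ← Matrix.mul_assoc, ih, Matrix.mul_assoc]

/-- The exchange of a flipped line and a line, both of which leave on the right in the state `1`. -/
lemma dualMonodromy_mul_monodromy (t : ℂ) {x y : ℂ} (h : y * x ≠ 1) (M : ℕ) (c a : Fin 2) :
    dualMonodromy t y M c 1 * monodromy t x M a 1 =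
      (∑ c' : Fin 2, ∑ a' : Fin 2, rWeight t (y * x) a c.rev a' c'.rev •
        (monodromy t x M a' 1 * dualMonodromy t y M c' 1)) -
      ((1 - t) * (y * x) / (1 - y * x)) • (dualMonodromy t y M c 0 * monodromy t x M a 0) := by
  -- The column (1, 1) of the crossing matrix has only two nonzero entries: 1 in row (1, 1), which
  -- gives the left-hand side, and (1 - t)w / (1 - w) in row (0, 0), which gives the subtracted
  -- term.
  have := congrFun (congrFun (exchange_monodromy t h M) (c, a)) (1, 1)
  simp only [Matrix.mul_apply, Fintype.sum_prod_type, Fin.sum_univ_two, tensorLeft, tensorRight,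
    crossingOp, crossing, Matrix.of_apply, Matrix.map_apply, Algebra.algebraMap_eq_smul_one,
    smul_mul_assoc, mul_smul_comm, one_mul, mul_one] at this
  simp only [Fin.sum_univ_two]
  rw [← this]
  simp [rWeight]
  exact (add_sub_cancel_left (G := Module.End ℂ Fock) _ _).symm

/-! ### The vacuum -/

/-- The state without particles. -/
def vacuum : Fock := Finsupp.single 0 1

lemma annihilation_vacuum (t : ℂ) (i : ℕ) : annihilation t i vacuum = 0 := by
  simp only [vacuum, annihilation_single, Finsupp.coe_zero, Pi.zero_apply, pow_zero, sub_self,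
    zero_smul]

/-- A dual row passes from 0 to 1 only by annihilating a particle, so over the vacuum it can end in
1 only if it starts in 1. After the flip this is the condition that the columns end in a hole at the
top. -/
lemma dualMonodromy_vacuum (t y : ℂ) (M : ℕ) :
    dualMonodromy t y M 0 1 vacuum = 0 ∧ dualMonodromy t y M 1 1 vacuum = vacuum := by
  induction M with
  | zero => simp [dualMonodromy]
  | succ M ih =>
    simp [dualMonodromy, Matrix.mul_apply, siteDualL, annihilation_vacuum, ih]

/-! ### The boundary covector -/

/-- The covector with coefficient `∏ (1 - t ^ (2 j - 1))` on the states with even occupation numbers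
and coefficient `0` on the others. -/
def evenCovector (t : ℂ) : Fock →ₗ[ℂ] ℂ :=
  Finsupp.linearCombination ℂ fun mu : PartState =>
    open scoped Classical in if ∀ i, Even (mu i) then evenCoeff t mu else 0

lemma evenCovector_single (t : ℂ) (mu : PartState) [Decidable (∀ i, Even (mu i))] :
    evenCovector t (Finsupp.single mu 1) = if ∀ i, Even (mu i) then evenCoeff t mu else 0 := by
  simp [evenCovector]

lemma evenCoeff_eq_prod (t : ℂ) (mu : PartState) {s : Finset ℕ} (h : mu.support ⊆ s) :
    evenCoeff t mu = ∏ i ∈ s, ∏ j ∈ Finset.Icc 1 (mu i / 2), (1 - t ^ (2 * j - 1)) :=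
  Finsupp.prod_of_support_subset _ h _ (by simp)

/-- At an occupation number 2k + 1, annihilation contributes 1 - t^(2k+1), exactly the factor by
which the coefficient grows from 2k to 2k + 2. At an even occupation number both sides vanish. -/
lemma evenCovector_annihilation (t : ℂ) (i : ℕ) :
    evenCovector t ∘ₗ annihilation t i = evenCovector t ∘ₗ creation i := by
  classical
  refine Finsupp.lhom_ext' fun mu => LinearMap.ext_ring ?_
  simp only [LinearMap.comp_apply, Finsupp.lsingle_apply, annihilation_single, creation_single,
    map_smul, evenCovector_single, smul_eq_mul]
  by_cases hm : mu i = 0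
  -- At an empty site truncated subtraction leaves the state unchanged, possibly with all
  -- occupations even, so the vanishing of the left side must come from the coefficient `1 - t ^ 0`.
  · rw [if_neg (c := ∀ j, Even ((mu + Finsupp.single i 1 : PartState) j))
      (fun h => by simpa [hm] using h i)]
    simp [hm]
  by_cases he : ∀ j, Even ((mu + Finsupp.single i 1 : PartState) j)
  · have hodd : Odd (mu i) := by
      have := he i
      simpa [Nat.even_add_one] using this
    have he' : ∀ j, Even ((mu - Finsupp.single i 1 : PartState) j) := fun j => by
      by_cases hj : j = i
      · subst hj
        simpa using Nat.Odd.sub_odd hodd odd_one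
      · simpa [Ne.symm hj, hj] using he j
    rw [if_pos he, if_pos he']
    have hs1 : (mu - Finsupp.single i 1).support ⊆ insert i (mu.support.erase i) := fun j hj => by
      by_cases hji : j = i
      · simp [hji]
      · simpa [hji, Ne.symm hji] using hj
    have hs2 : (mu + Finsupp.single i 1).support ⊆ insert i (mu.support.erase i) := fun j hj => by
      by_cases hji : j = i
      · simp [hji]
      · simpa [hji, Ne.symm hji] using hj
    rw [evenCoeff_eq_prod t _ hs1, evenCoeff_eq_prod t _ hs2, Finset.prod_insert (by simp),
      Finset.prod_insert (by simp), ← mul_assoc]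
    obtain ⟨k, hk⟩ := hodd
    congr 1
    · simp only [Finsupp.coe_tsub, Pi.sub_apply, Finsupp.single_eq_same, Finsupp.coe_add,
        Pi.add_apply, hk]
      rw [show (2 * k + 1 - 1) / 2 = k by omega, show (2 * k + 1 + 1) / 2 = k + 1 by omega,
        ← Finset.insert_Icc_right_eq_Icc_add_one (by omega), Finset.prod_insert (by simp)]
      rw [show 2 * (k + 1) - 1 = 2 * k + 1 by omega]
    · refine Finset.prod_congr rfl fun j hj => ?_
      have : j ≠ i := Finset.ne_of_mem_erase hj
      simp [this]
  · rw [if_neg he, if_neg, mul_zero]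
    intro he'
    refine he fun j => ?_
    by_cases hj : j = i
    · subst hj
      have := he' j
      simp at this ⊢
      rcases this with ⟨k, hk⟩
      exact ⟨k + 1, by omega⟩
    · simpa [Ne.symm hj, hj] using he' j

lemma evenCovector_siteL (t x : ℂ) (i : ℕ) (a b : Fin 2) :
    evenCovector t ∘ₗ siteL t x i a b = evenCovector t ∘ₗ siteDualL t x i a b := by
  fin_cases a <;> fin_cases b <;>
    simp [siteL, siteDualL, LinearMap.comp_smul, evenCovector_annihilation]

/-- The reflection property of the boundary covector. -/
lemma evenCovector_monodromy (t x : ℂ) (M : ℕ) (a b : Fin 2) :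
    evenCovector t ∘ₗ monodromy t x M a b = evenCovector t ∘ₗ dualMonodromy t x M a b := by
  induction M generalizing a b with
  | zero => rfl
  | succ M ih =>
    rw [monodromy, dualMonodromy, Matrix.mul_apply, Matrix.mul_apply, Fin.sum_univ_two,
      Fin.sum_univ_two, LinearMap.comp_add, LinearMap.comp_add]
    suffices h : ∀ c, evenCovector t ∘ₗ (monodromy t x M a c * siteL t x M c b) =
        evenCovector t ∘ₗ (dualMonodromy t x M a c * siteDualL t x M c b) by rw [h, h]
    intro c
    -- Once the first M sites are reflected, the matrix at site M commutes past them, is reflected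
    -- next to the covector, and is moved back.
    rw [Module.End.mul_eq_comp, ← LinearMap.comp_assoc, ih, LinearMap.comp_assoc,
      ← Module.End.mul_eq_comp, ((commutesAt_dualMonodromy t x le_rfl a c).siteL x c b).eq,
      Module.End.mul_eq_comp, ← LinearMap.comp_assoc, evenCovector_siteL, LinearMap.comp_assoc,
      ← Module.End.mul_eq_comp, ← ((commutesAt_dualMonodromy t x le_rfl a c).siteDualL x c b).eq]

/-! ### Particle numbers -/

lemma numParts_add (mu nu : PartState) : numParts (mu + nu) = numParts mu + numParts nu :=
  Finsupp.sum_add_index' (fun _ => rfl) fun _ _ _ => rfl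

lemma weight_add (mu nu : PartState) : weight (mu + nu) = weight mu + weight nu :=
  Finsupp.sum_add_index' (fun _ => mul_zero _) fun _ _ _ => mul_add _ _ _

lemma numParts_single (i k : ℕ) : numParts (Finsupp.single i k) = k := by
  simp [numParts]

lemma weight_single (i k : ℕ) : weight (Finsupp.single i k) = i * k := by
  simp [weight]

lemma sub_single_add_single {mu : PartState} {i : ℕ} (h : mu i ≠ 0) :
    mu - Finsupp.single i 1 + Finsupp.single i 1 = mu :=
  tsub_add_cancel_of_le (by simpa [Finsupp.single_le_iff] using Nat.one_le_iff_ne_zero.2 h)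

lemma numParts_sub_single {mu : PartState} {i : ℕ} (h : mu i ≠ 0) :
    numParts (mu - Finsupp.single i 1) + 1 = numParts mu := by
  conv_rhs => rw [← sub_single_add_single h, numParts_add, numParts_single]

lemma weight_sub_single {mu : PartState} {i : ℕ} (h : mu i ≠ 0) :
    weight (mu - Finsupp.single i 1) + i = weight mu := by
  conv_rhs => rw [← sub_single_add_single h, weight_add, weight_single, mul_one]

/-- The operators which change the number of particles by `b - a`. -/
def Shifts (a b : ℕ) (A : Module.End ℂ Fock) : Prop :=
  ∀ mu : PartState, ∀ lam ∈ (A (Finsupp.single mu 1)).support, numParts lam + a = numParts mu + b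

lemma apply_eq_sum (A : Fock →ₗ[ℂ] Fock) (f : Fock) :
    A f = f.sum fun mu c => c • A (Finsupp.single mu 1) := by
  conv_lhs => rw [← Finsupp.sum_single f]
  rw [map_finsuppSum]
  refine Finsupp.sum_congr fun mu _ => ?_
  rw [← map_smul, Finsupp.smul_single_one]

lemma exists_of_mem_support_apply {A : Module.End ℂ Fock} {f : Fock} {lam : PartState}
    (h : lam ∈ (A f).support) :
    ∃ mu ∈ f.support, lam ∈ (A (Finsupp.single mu 1)).support := by
  by_contra! hc
  refine Finsupp.mem_support_iff.1 h ?_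
  rw [apply_eq_sum, Finsupp.sum, Finsupp.finsetSum_apply]
  refine Finset.sum_eq_zero fun mu hmu => ?_
  rw [Finsupp.smul_apply, Finsupp.notMem_support_iff.1 (hc mu hmu), smul_zero]

lemma Shifts.mul {a b c : ℕ} {A B : Module.End ℂ Fock} (hA : Shifts a c A) (hB : Shifts c b B) :
    Shifts a b (A * B) := fun mu lam h => by
  rw [Module.End.mul_apply] at h
  obtain ⟨nu, hnu, hlam⟩ := exists_of_mem_support_apply h
  have := hA nu lam hlam
  have := hB mu nu hnu
  omega

lemma Shifts.add {a b : ℕ} {A B : Module.End ℂ Fock} (hA : Shifts a b A) (hB : Shifts a b B) :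
    Shifts a b (A + B) := fun mu lam h => by
  classical
  rcases Finset.mem_union.1 (Finsupp.support_add h) with h | h
  exacts [hA mu lam h, hB mu lam h]

lemma Shifts.smul {a b : ℕ} {A : Module.End ℂ Fock} (hA : Shifts a b A) (c : ℂ) :
    Shifts a b (c • A) := fun mu lam h => hA mu lam (Finsupp.support_smul h)

lemma shifts_one (a : ℕ) : Shifts a a 1 := fun mu lam h => by
  have := Finsupp.support_single_subset h
  simp_all

lemma shifts_zero (a b : ℕ) : Shifts a b 0 := fun mu lam h => by simp at h

lemma shifts_creation (i : ℕ) : Shifts 0 1 (creation i) := fun mu lam h => by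
  rw [creation_single] at h
  have := Finset.mem_singleton.1 (Finsupp.support_single_subset h)
  simp [this, numParts_add, numParts_single]

lemma shifts_annihilation (t : ℂ) (i : ℕ) : Shifts 1 0 (annihilation t i) := fun mu lam h => by
  rw [annihilation_single] at h
  by_cases hm : mu i = 0
  · simp [hm] at h
  · have := Finset.mem_singleton.1 (Finsupp.support_single_subset (Finsupp.support_smul h))
    rw [this, numParts_sub_single hm, add_zero]

lemma shifts_siteL (t x : ℂ) (i : ℕ) (a b : Fin 2) : Shifts a b (siteL t x i a b) := by
  fin_cases a <;> fin_cases b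
  · exact (shifts_one 0).smul x
  · exact (shifts_creation i).smul x
  · exact shifts_annihilation t i
  · exact shifts_one 1

lemma shifts_siteDualL (t x : ℂ) (i : ℕ) (a b : Fin 2) : Shifts b a (siteDualL t x i a b) := by
  fin_cases a <;> fin_cases b
  · exact (shifts_one 0).smul x
  · exact (shifts_annihilation t i).smul x
  · exact shifts_creation i
  · exact shifts_one 1

lemma shifts_monodromy (t x : ℂ) (M : ℕ) (a b : Fin 2) : Shifts a b (monodromy t x M a b) := by
  induction M generalizing a b with
  | zero =>
    rcases eq_or_ne a b with rfl | h
    · rw [monodromy, Matrix.one_apply_eq]; exact shifts_one _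
    · rw [monodromy, Matrix.one_apply_ne h]; exact shifts_zero _ _
  | succ M ih =>
    rw [monodromy, Matrix.mul_apply, Fin.sum_univ_two]
    exact ((ih _ _).mul (shifts_siteL t x M _ _)).add ((ih _ _).mul (shifts_siteL t x M _ _))

/-- Changes of particle number add up in either order; this form suits dual rows, whose indices are
composed in the opposite direction. -/
lemma Shifts.mul' {a b c : ℕ} {A B : Module.End ℂ Fock} (hA : Shifts c a A) (hB : Shifts b c B) :
    Shifts b a (A * B) := fun mu lam h => by
  rw [Module.End.mul_apply] at h
  obtain ⟨nu, hnu, hlam⟩ := exists_of_mem_support_apply h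
  have := hA nu lam hlam
  have := hB mu nu hnu
  omega

lemma shifts_dualMonodromy (t x : ℂ) (M : ℕ) (a b : Fin 2) :
    Shifts b a (dualMonodromy t x M a b) := by
  induction M generalizing a b with
  | zero =>
    rcases eq_or_ne a b with rfl | h
    · rw [dualMonodromy, Matrix.one_apply_eq]; exact shifts_one _
    · rw [dualMonodromy, Matrix.one_apply_ne h]; exact shifts_zero _ _
  | succ M ih =>
    rw [dualMonodromy, Matrix.mul_apply, Fin.sum_univ_two]
    exact ((ih _ _).mul' (shifts_siteDualL t x M _ _)).add
      ((ih _ _).mul' (shifts_siteDualL t x M _ _))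

/-- The vectors with at most `n` particles. -/
def sector (n : ℕ) : Submodule ℂ Fock := Finsupp.supported ℂ ℂ {lam | numParts lam ≤ n}

lemma mem_sector {n : ℕ} {f : Fock} : f ∈ sector n ↔ ∀ lam ∈ f.support, numParts lam ≤ n := by
  rw [sector, Finsupp.mem_supported]
  exact Iff.rfl

lemma sector_mono {m n : ℕ} (h : m ≤ n) : sector m ≤ sector n := fun _ hf =>
  mem_sector.2 fun lam hl => (mem_sector.1 hf lam hl).trans h

lemma Shifts.apply_mem_sector {a b n : ℕ} {A : Module.End ℂ Fock} (hA : Shifts a b A) {f : Fock}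
    (hf : f ∈ sector n) : A f ∈ sector (n + b) := mem_sector.2 fun lam h => by
  obtain ⟨mu, hmu, hlam⟩ := exists_of_mem_support_apply h
  have := hA mu lam hlam
  have := mem_sector.1 hf mu hmu
  omega

/-! ### Weighted norms -/

/-- The weighted norm `∑ r ^ |λ| |f_λ|`. -/
def fockNorm (r : ℝ) (f : Fock) : ℝ := f.sum fun lam c => r ^ weight lam * ‖c‖

lemma fockNorm_eq_sum {r : ℝ} {f : Fock} {s : Finset PartState} (h : f.support ⊆ s) :
    fockNorm r f = ∑ lam ∈ s, r ^ weight lam * ‖f lam‖ :=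
  Finsupp.sum_of_support_subset _ h _ (by simp)

lemma fockNorm_nonneg {r : ℝ} (hr : 0 ≤ r) (f : Fock) : 0 ≤ fockNorm r f :=
  Finset.sum_nonneg fun _ _ => by positivity

@[simp] lemma fockNorm_zero (r : ℝ) : fockNorm r 0 = 0 := by simp [fockNorm]

lemma fockNorm_single (r : ℝ) (mu : PartState) (c : ℂ) :
    fockNorm r (Finsupp.single mu c) = r ^ weight mu * ‖c‖ := by simp [fockNorm]

lemma fockNorm_smul (r : ℝ) (c : ℂ) (f : Fock) : fockNorm r (c • f) = ‖c‖ * fockNorm r f := by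
  rw [fockNorm_eq_sum (Finsupp.support_smul (b := c) (g := f)), fockNorm, Finsupp.sum,
    Finset.mul_sum]
  refine Finset.sum_congr rfl fun lam _ => ?_
  rw [Finsupp.smul_apply, norm_smul]
  ring

lemma fockNorm_add_le {r : ℝ} (hr : 0 ≤ r) (f g : Fock) :
    fockNorm r (f + g) ≤ fockNorm r f + fockNorm r g := by
  classical
  rw [fockNorm_eq_sum (Finsupp.support_add (g₁ := f) (g₂ := g)),
    fockNorm_eq_sum (Finset.subset_union_left (s₁ := f.support) (s₂ := g.support)),
    fockNorm_eq_sum (Finset.subset_union_right (s₁ := f.support) (s₂ := g.support)),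
    ← Finset.sum_add_distrib]
  refine Finset.sum_le_sum fun lam _ => ?_
  rw [← mul_add]
  exact mul_le_mul_of_nonneg_left (norm_add_le _ _) (by positivity)

lemma fockNorm_sum_le {r : ℝ} (hr : 0 ≤ r) {ι : Type*} (s : Finset ι) (f : ι → Fock) :
    fockNorm r (∑ i ∈ s, f i) ≤ ∑ i ∈ s, fockNorm r (f i) := by
  classical
  induction s using Finset.induction_on with
  | empty => simp
  | insert i s hi ih =>
    rw [Finset.sum_insert hi, Finset.sum_insert hi]
    exact (fockNorm_add_le hr _ _).trans (by gcongr)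

lemma fockNorm_mono {r r' : ℝ} (hr : 0 ≤ r) (h : r ≤ r') (f : Fock) :
    fockNorm r f ≤ fockNorm r' f := by
  refine Finset.sum_le_sum fun _ _ => ?_
  dsimp only
  gcongr

lemma fockNorm_apply_le {r K : ℝ} (hr : 0 ≤ r) {n : ℕ} {A : Module.End ℂ Fock}
    (hA : ∀ mu, numParts mu ≤ n → fockNorm r (A (Finsupp.single mu 1)) ≤ K * r ^ weight mu)
    {f : Fock} (hf : f ∈ sector n) : fockNorm r (A f) ≤ K * fockNorm r f := by
  rw [apply_eq_sum, Finsupp.sum, fockNorm_eq_sum (Finset.Subset.refl f.support), Finset.mul_sum]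
  refine (fockNorm_sum_le hr _ _).trans (Finset.sum_le_sum fun mu hmu => ?_)
  rw [fockNorm_smul]
  calc _ ≤ ‖f mu‖ * (K * r ^ weight mu) := by
        gcongr
        exact hA mu (mem_sector.1 hf mu hmu)
    _ = _ := by ring

lemma norm_one_sub_pow_le (t : ℂ) (m : ℕ) (hm : m ≠ 0) : ‖1 - t ^ m‖ ≤ (1 + ‖t‖) ^ m := by
  calc ‖1 - t ^ m‖ ≤ 1 + ‖t‖ ^ m := by simpa using norm_sub_le (1 : ℂ) (t ^ m)
    _ ≤ (1 + ‖t‖) ^ m := by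
      simpa using pow_add_pow_le (zero_le_one) (norm_nonneg t) hm

lemma sum_range_le_numParts (mu : PartState) (M : ℕ) :
    ∑ i ∈ Finset.range M, mu i ≤ numParts mu := by
  classical
  rw [numParts, Finsupp.sum_of_support_subset mu (Finset.subset_union_left
    (s₂ := Finset.range M)) _ (by simp)]
  exact Finset.sum_le_sum_of_subset Finset.subset_union_right

lemma fockNorm_annihilation_le {r : ℝ} (hr : 0 ≤ r) (t : ℂ) (A : Module.End ℂ Fock) (i : ℕ)
    {mu : PartState} (hm : mu i ≠ 0) :
    fockNorm r (A (annihilation t i (Finsupp.single mu 1))) ≤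
      (1 + ‖t‖) ^ mu i * fockNorm r (A (Finsupp.single (mu - Finsupp.single i 1) 1)) := by
  rw [annihilation_single, map_smul, fockNorm_smul]
  gcongr
  · exact fockNorm_nonneg hr _
  · exact norm_one_sub_pow_le t _ hm

lemma annihilation_single_of_eq_zero (t : ℂ) {i : ℕ} {mu : PartState} (hm : mu i = 0) :
    annihilation t i (Finsupp.single mu 1) = 0 := by
  rw [annihilation_single, hm, pow_zero, sub_self, zero_smul]

lemma one_add_mul_pow_le {C d : ℝ} (hC : 1 ≤ C) (hd : 0 ≤ d) {m : ℕ} (hm : m ≠ 0) :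
    1 + d * C ^ m ≤ (C * (1 + d)) ^ m := by
  have h1 : 1 ≤ C ^ m := one_le_pow₀ hC
  have h2 : 1 + d ≤ (1 + d) ^ m := le_self_pow₀ (by linarith) hm
  rw [mul_pow]
  nlinarith

/-- A particle removed at site i lowers the weight by i, and the hole then costs ‖x‖ at each later
site, so a row ending in a hole is of order r^(-M). The bounds p and q for the two columns are
combined into a potential that does not grow at empty sites; hence it depends on the number of
particles and not on M. Only the occupations below M enter p and q, so the induction may alter the
occupation of site M. -/
lemma monodromy_basis_bound (t : ℂ) {x : ℂ} {r s : ℝ} (hr : 1 ≤ r) (hs : 0 < s) (hs1 : s < 1)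
    (hx : r * ‖x‖ ≤ s) (a : Fin 2) (M : ℕ) (mu : PartState) :
    ∃ p q : ℝ, 0 ≤ p ∧ 0 ≤ q ∧
      q + s / (1 - s) * p ≤
        (1 + s / (1 - s)) * ((1 + ‖t‖) * (1 + s / (1 - s) * r)) ^ ∑ i ∈ Finset.range M, mu i ∧
      ∀ nu : PartState, (∀ i < M, nu i = mu i) →
        r ^ M * fockNorm r (monodromy t x M a 0 (Finsupp.single nu 1)) ≤ p * r ^ weight nu ∧
        fockNorm r (monodromy t x M a 1 (Finsupp.single nu 1)) ≤ q * r ^ weight nu := by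
  have hs2 : 0 < 1 - s := by linarith
  have hr0 : 0 ≤ r := by linarith
  set d := s / (1 - s) with hd
  have hd0 : 0 ≤ d := by positivity
  -- The constant d is chosen as the fixed point of d ↦ s(1 + d), so that q + d p is preserved by
  -- the update at an empty site.
  have hds : s * (1 + d) = d := by rw [hd]; field_simp; ring
  have hx' : ‖x‖ ≤ s := by nlinarith [norm_nonneg x]
  induction M generalizing mu with
  | zero =>
    refine ⟨1 - a.val, a.val, ?_, by positivity, ?_, fun nu _ => ?_⟩
    · fin_cases a <;> simp
    · fin_cases a <;> simp [hd0]
    · obtain rfl | rfl : a = 0 ∨ a = 1 := by fin_cases a <;> simp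
      all_goals simp [monodromy, fockNorm_single]
  | succ M ih =>
    obtain ⟨p, q, hp, hq, hpq, h⟩ := ih mu
    -- The cost of annihilating at site M. The factor r is what is left of r^(M+1) after the weight
    -- has dropped by M.
    set e : ℝ := if mu M = 0 then 0 else r * (1 + ‖t‖) ^ mu M with he
    have he0 : 0 ≤ e := by rw [he]; split_ifs <;> positivity
    refine ⟨s * p + e * q, s * p + q, by positivity, by positivity, ?_, fun nu hnu => ?_⟩
    · have h1 : s * p + q + d * (s * p + e * q) ≤ (q + d * p) * (1 + d * e) := by
        have : s * p + q + d * (s * p + e * q) = q + s * (1 + d) * p + d * e * q := by ring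
        rw [this, hds]
        have : 0 ≤ d * p * (d * e) := by positivity
        nlinarith
      refine h1.trans ?_
      rw [Finset.sum_range_succ, pow_add, ← mul_assoc]
      gcongr
      by_cases hm : mu M = 0
      · simp [he, hm]
      · rw [he, if_neg hm]
        have := one_add_mul_pow_le (C := 1 + ‖t‖) (d := d * r) (by simp) (by positivity) hm
        rwa [mul_assoc] at this
    · have hlow : ∀ i < M, nu i = mu i := fun i hi => hnu i (by omega)
      have hM : nu M = mu M := hnu M (by omega)
      obtain ⟨h0, h1⟩ := h nu hlow
      obtain ⟨h0', -⟩ := h (nu + Finsupp.single M 1) fun i hi => by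
        simp [hlow i hi, (Nat.ne_of_lt hi)]
      simp only [monodromy, Matrix.mul_apply, Fin.sum_univ_two, LinearMap.add_apply,
        Module.End.mul_apply, siteL, Matrix.of_apply, Matrix.cons_val', Matrix.cons_val_zero,
        Matrix.cons_val_one, Matrix.cons_val_fin_one, LinearMap.smul_apply, Module.End.one_apply,
        map_smul, creation_single]
      constructor
      · have hlast : r ^ (M + 1) * fockNorm r
            (monodromy t x M a 1 (annihilation t M (Finsupp.single nu 1))) ≤
              e * q * r ^ weight nu := by
          by_cases hm : nu M = 0
          · rw [annihilation_single_of_eq_zero t hm, map_zero, fockNorm_zero, mul_zero]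
            positivity
          · obtain ⟨-, h1'⟩ := h (nu - Finsupp.single M 1) fun i hi => by
              simp [hlow i hi, (Nat.ne_of_lt hi)]
            rw [he, if_neg (hM ▸ hm), ← weight_sub_single hm, ← hM]
            calc _ ≤ r ^ (M + 1) * ((1 + ‖t‖) ^ nu M * (q * r ^ weight (nu - Finsupp.single M 1))) := by
                  gcongr
                  exact (fockNorm_annihilation_le hr0 t _ M hm).trans (by gcongr)
              _ = _ := by ring
        calc _ ≤ r ^ (M + 1) * (‖x‖ * fockNorm r (monodromy t x M a 0 (Finsupp.single nu 1)) +
              fockNorm r (monodromy t x M a 1 (annihilation t M (Finsupp.single nu 1)))) := by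
                gcongr
                refine (fockNorm_add_le hr0 _ _).trans ?_
                rw [fockNorm_smul]
          _ = r * ‖x‖ * (r ^ M * fockNorm r (monodromy t x M a 0 (Finsupp.single nu 1))) +
              r ^ (M + 1) *
                fockNorm r (monodromy t x M a 1 (annihilation t M (Finsupp.single nu 1))) := by ring
          _ ≤ s * (p * r ^ weight nu) + e * q * r ^ weight nu := by
                gcongr
                exact mul_nonneg (by positivity) (fockNorm_nonneg hr0 _)
          _ = _ := by ring
      · rw [weight_add, weight_single, mul_one, pow_add, ← mul_assoc, mul_comm (r ^ M)] at h0'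
        have h0'' := le_of_mul_le_mul_right h0' (by positivity)
        calc _ ≤ ‖x‖ * fockNorm r (monodromy t x M a 0
                (Finsupp.single (nu + Finsupp.single M 1) 1)) +
              fockNorm r (monodromy t x M a 1 (Finsupp.single nu 1)) := by
                refine (fockNorm_add_le hr0 _ _).trans ?_
                rw [fockNorm_smul]
          _ ≤ s * (p * r ^ weight nu) + q * r ^ weight nu := by
                gcongr
                exact fockNorm_nonneg hr0 _
          _ = _ := by ring

/-- In a dual row holes appear by creation, possible at every site, and the costs s of the later
sites sum to a geometric series, whence the factor 1 - s. Returning to 1 needs an occupied site,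
which again bounds the growth by the number of particles. The norm is the unweighted one, since
creation far to the right raises the weight. -/
lemma dualMonodromy_basis_bound (t : ℂ) {x : ℂ} {s : ℝ} (hs1 : s < 1)
    (hx : ‖x‖ ≤ s) (a : Fin 2) (M : ℕ) (mu : PartState) :
    ∃ p q : ℝ, 0 ≤ p ∧ 0 ≤ q ∧
      (1 - s) * p ≤ ((1 + ‖t‖) * (1 + s / (1 - s))) ^ ∑ i ∈ Finset.range M, mu i ∧
      q ≤ ((1 + ‖t‖) * (1 + s / (1 - s))) ^ ∑ i ∈ Finset.range M, mu i ∧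
      ∀ nu : PartState, (∀ i < M, nu i = mu i) →
        fockNorm 1 (dualMonodromy t x M a 0 (Finsupp.single nu 1)) ≤ p ∧
        fockNorm 1 (dualMonodromy t x M a 1 (Finsupp.single nu 1)) ≤ q := by
  have hs2 : 0 < 1 - s := by linarith
  have hs : 0 ≤ s := (norm_nonneg x).trans hx
  set d := s / (1 - s) with hd
  have hd0 : 0 ≤ d := by positivity
  induction M generalizing mu with
  | zero =>
    refine ⟨1 - a.val, a.val, ?_, by positivity, ?_, ?_, fun nu _ => ?_⟩
    · fin_cases a <;> simp
    · fin_cases a <;> simp [hs]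
    · fin_cases a <;> simp
    · obtain rfl | rfl : a = 0 ∨ a = 1 := by fin_cases a <;> simp
      all_goals simp [dualMonodromy, fockNorm_single]
  | succ M ih =>
    obtain ⟨p, q, hp, hq, hpK, hqK, h⟩ := ih mu
    set U := ((1 + ‖t‖) * (1 + d)) ^ ∑ i ∈ Finset.range M, mu i with hU
    have hU0 : 0 ≤ U := by positivity
    set e : ℝ := if mu M = 0 then 0 else (1 + ‖t‖) ^ mu M with he
    have he0 : 0 ≤ e := by rw [he]; split_ifs <;> positivity
    have hstep : U * (1 + d * e) ≤
        ((1 + ‖t‖) * (1 + d)) ^ ∑ i ∈ Finset.range (M + 1), mu i := by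
      rw [Finset.sum_range_succ, pow_add, ← hU]
      gcongr
      by_cases hm : mu M = 0
      · simp [he, hm]
      · rw [he, if_neg hm]
        exact one_add_mul_pow_le (by simp) hd0 hm
    refine ⟨s * p + q, s * e * p + q, by positivity, by positivity, le_trans ?_ hstep,
      le_trans ?_ hstep, fun nu hnu => ?_⟩
    · have : 0 ≤ U * (d * e) := by positivity
      nlinarith
    · have : s * p ≤ d * U := by
        rw [hd, div_mul_eq_mul_div, le_div_iff₀ hs2]
        nlinarith
      nlinarith
    · have hlow : ∀ i < M, nu i = mu i := fun i hi => hnu i (by omega)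
      have hM : nu M = mu M := hnu M (by omega)
      obtain ⟨h0, h1⟩ := h nu hlow
      obtain ⟨-, h1'⟩ := h (nu + Finsupp.single M 1) fun i hi => by
        simp [hlow i hi, (Nat.ne_of_lt hi)]
      simp only [dualMonodromy, Matrix.mul_apply, Fin.sum_univ_two, LinearMap.add_apply,
        Module.End.mul_apply, siteDualL, Matrix.of_apply, Matrix.cons_val', Matrix.cons_val_zero,
        Matrix.cons_val_one, Matrix.cons_val_fin_one, LinearMap.smul_apply, Module.End.one_apply,
        map_smul, creation_single]
      constructor
      · refine (fockNorm_add_le zero_le_one _ _).trans ?_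
        rw [fockNorm_smul]
        gcongr
        exact fockNorm_nonneg zero_le_one _
      · refine (fockNorm_add_le zero_le_one _ _).trans ?_
        rw [fockNorm_smul, mul_assoc]
        gcongr
        · exact fockNorm_nonneg zero_le_one _
        by_cases hm : nu M = 0
        · rw [annihilation_single_of_eq_zero t hm, map_zero, fockNorm_zero]
          positivity
        · obtain ⟨h0', -⟩ := h (nu - Finsupp.single M 1) fun i hi => by
            simp [hlow i hi, (Nat.ne_of_lt hi)]
          rw [he, if_neg (hM ▸ hm), ← hM]
          exact (fockNorm_annihilation_le zero_le_one t _ M hm).trans (by gcongr)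

lemma exists_monodromy_bound (t : ℂ) {x : ℂ} {r : ℝ} (hr : 1 ≤ r) (hx : r * ‖x‖ < 1) (n : ℕ) :
    ∃ K : ℝ, ∀ (M : ℕ) (a : Fin 2), ∀ f ∈ sector n,
      r ^ M * fockNorm r (monodromy t x M a 0 f) ≤ K * fockNorm r f ∧
      fockNorm r (monodromy t x M a 1 f) ≤ K * fockNorm r f := by
  obtain ⟨s, hs, hs1⟩ := exists_between hx
  have hs0 : 0 < s := lt_of_le_of_lt (by positivity) hs
  have hs2 : 0 < 1 - s := by linarith
  have hr0 : 0 < r := by linarith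
  set d := s / (1 - s) with hd
  have hd0 : 0 < d := by positivity
  set B := (1 + d) * ((1 + ‖t‖) * (1 + d * r)) ^ n with hB
  have hB0 : 0 ≤ B := by positivity
  refine ⟨B + B / d, fun M a f hf => ?_⟩
  have key : ∀ mu : PartState, numParts mu ≤ n →
      r ^ M * fockNorm r (monodromy t x M a 0 (Finsupp.single mu 1)) ≤
        (B + B / d) * r ^ weight mu ∧
      fockNorm r (monodromy t x M a 1 (Finsupp.single mu 1)) ≤ (B + B / d) * r ^ weight mu := by
    intro mu hmu
    obtain ⟨p, q, hp, hq, hpq, h⟩ := monodromy_basis_bound t hr hs0 hs1 hs.le a M mu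
    obtain ⟨h0, h1⟩ := h mu fun _ _ => rfl
    have hle : q + d * p ≤ B := by
      refine hpq.trans ?_
      rw [hB]
      gcongr
      · have h3 : 1 ≤ 1 + d * r := by simp; positivity
        have h4 : 1 ≤ 1 + ‖t‖ := by simp
        exact one_le_mul_of_one_le_of_one_le h4 h3
      · exact (sum_range_le_numParts mu M).trans hmu
    have hdB : 0 ≤ B / d := by positivity
    have hdp : 0 ≤ d * p := by positivity
    have hpB : p ≤ B / d := by rw [le_div_iff₀ hd0]; linarith
    exact ⟨h0.trans (by gcongr; linarith), h1.trans (by gcongr; linarith)⟩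
  refine ⟨?_, fockNorm_apply_le hr0.le (fun mu hmu => (key mu hmu).2) hf⟩
  have hrM : 0 < r ^ M := by positivity
  have := fockNorm_apply_le (K := (B + B / d) / r ^ M) hr0.le (fun mu hmu => by
    rw [div_mul_eq_mul_div, le_div_iff₀ hrM, mul_comm]
    exact (key mu hmu).1) hf
  rwa [div_mul_eq_mul_div, le_div_iff₀ hrM, mul_comm] at this

lemma exists_dualMonodromy_bound (t : ℂ) {x : ℂ} (hx : ‖x‖ < 1) (n : ℕ) :
    ∃ K : ℝ, ∀ (M : ℕ) (a : Fin 2), ∀ f ∈ sector n,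
      fockNorm 1 (dualMonodromy t x M a 0 f) ≤ K * fockNorm 1 f := by
  have hs2 : 0 < 1 - ‖x‖ := by linarith
  refine ⟨((1 + ‖t‖) * (1 + ‖x‖ / (1 - ‖x‖))) ^ n / (1 - ‖x‖), fun M a f hf =>
    fockNorm_apply_le zero_le_one (fun mu hmu => ?_) hf⟩
  obtain ⟨p, q, -, -, hp, -, h⟩ := dualMonodromy_basis_bound t hx le_rfl a M mu
  rw [one_pow, mul_one]
  refine (h mu fun _ _ => rfl).1.trans ?_
  rw [le_div_iff₀ hs2, mul_comm]
  refine hp.trans ?_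
  gcongr
  · have h3 : 1 ≤ 1 + ‖x‖ / (1 - ‖x‖) := by simp; positivity
    have h4 : 1 ≤ 1 + ‖t‖ := by simp
    exact one_le_mul_of_one_le_of_one_le h4 h3
  · exact (sum_range_le_numParts mu M).trans hmu

lemma apply_le_numParts (mu : PartState) (i : ℕ) : mu i ≤ numParts mu :=
  (Finset.single_le_sum (f := fun j => mu j) (fun _ _ => Nat.zero_le _)
    (Finset.self_mem_range_succ i)).trans (sum_range_le_numParts mu (i + 1))

lemma norm_evenCoeff_le (t : ℂ) {mu : PartState} {n : ℕ} (h : numParts mu ≤ n) :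
    ‖evenCoeff t mu‖ ≤ ((1 + ‖t‖) ^ n) ^ n := by
  have hC : 1 ≤ 1 + ‖t‖ := by simp
  have hCn : 1 ≤ (1 + ‖t‖) ^ n := one_le_pow₀ hC
  calc ‖evenCoeff t mu‖ = ∏ i ∈ mu.support, ∏ j ∈ Finset.Icc 1 (mu i / 2), ‖1 - t ^ (2 * j - 1)‖ := by
        rw [evenCoeff, Finsupp.prod, norm_prod]
        simp only [norm_prod]
    _ ≤ ∏ i ∈ mu.support, ((1 + ‖t‖) ^ n) ^ mu i := by
        refine Finset.prod_le_prod (fun _ _ => Finset.prod_nonneg fun _ _ => norm_nonneg _)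
          fun i _ => ?_
        calc _ ≤ ∏ j ∈ Finset.Icc 1 (mu i / 2), (1 + ‖t‖) ^ n := by
              refine Finset.prod_le_prod (fun _ _ => norm_nonneg _) fun j hj => ?_
              have := Finset.mem_Icc.1 hj
              have := apply_le_numParts mu i
              exact (norm_one_sub_pow_le t _ (by omega)).trans
                (pow_le_pow_right₀ hC (by omega))
          _ ≤ _ := by
              rw [Finset.prod_const, Nat.card_Icc]
              exact pow_le_pow_right₀ hCn (by omega)
    _ = ((1 + ‖t‖) ^ n) ^ numParts mu := by rw [Finset.prod_pow_eq_pow_sum]; rfl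
    _ ≤ _ := pow_le_pow_right₀ hCn h

lemma norm_evenCovector_le (t : ℂ) {n : ℕ} {f : Fock} (hf : f ∈ sector n) :
    ‖evenCovector t f‖ ≤ ((1 + ‖t‖) ^ n) ^ n * fockNorm 1 f := by
  classical
  rw [evenCovector, Finsupp.linearCombination_apply, Finsupp.sum, fockNorm, Finsupp.sum,
    Finset.mul_sum]
  refine (norm_sum_le _ _).trans (Finset.sum_le_sum fun mu hmu => ?_)
  rw [one_pow, one_mul, norm_smul, mul_comm]
  gcongr
  split_ifs
  · exact norm_evenCoeff_le t (mem_sector.1 hf mu hmu)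
  · rw [norm_zero]; positivity

/-! ### Sequences of vectors -/

/-- The sequences of vectors with boundedly many particles and bounded norm. -/
def BoundedSeq (r : ℝ) (f : ℕ → Fock) : Prop :=
  ∃ (n : ℕ) (K : ℝ), ∀ M, f M ∈ sector n ∧ fockNorm r (f M) ≤ K

/-- The sequences of vectors with boundedly many particles and norm tending to zero. -/
def NegligibleSeq (f : ℕ → Fock) : Prop :=
  (∃ n : ℕ, ∀ M, f M ∈ sector n) ∧ Tendsto (fun M => fockNorm 1 (f M)) atTop (𝓝 0)

lemma negligibleSeq_of_le {f : ℕ → Fock} {n : ℕ} (hf : ∀ M, f M ∈ sector n) {u : ℕ → ℝ}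
    (hu : Tendsto u atTop (𝓝 0)) (h : ∀ M, fockNorm 1 (f M) ≤ u M) : NegligibleSeq f :=
  ⟨⟨n, hf⟩, squeeze_zero (fun _ => fockNorm_nonneg zero_le_one _) h hu⟩

lemma negligibleSeq_zero : NegligibleSeq fun _ => 0 :=
  ⟨⟨0, fun _ => zero_mem _⟩, by simp⟩

lemma NegligibleSeq.add {f g : ℕ → Fock} (hf : NegligibleSeq f) (hg : NegligibleSeq g) :
    NegligibleSeq fun M => f M + g M := by
  obtain ⟨⟨m, hm⟩, hf⟩ := hf
  obtain ⟨⟨n, hn⟩, hg⟩ := hg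
  exact negligibleSeq_of_le
    (fun M => add_mem (sector_mono (le_max_left m n) (hm M)) (sector_mono (le_max_right m n) (hn M)))
    (by simpa using hf.add hg) fun M => fockNorm_add_le zero_le_one _ _

lemma NegligibleSeq.smul {f : ℕ → Fock} (hf : NegligibleSeq f) (c : ℂ) :
    NegligibleSeq fun M => c • f M := by
  obtain ⟨⟨m, hm⟩, hf⟩ := hf
  exact negligibleSeq_of_le (fun M => Submodule.smul_mem _ c (hm M))
    (by simpa using hf.const_mul ‖c‖) fun M => (fockNorm_smul 1 c _).le

lemma NegligibleSeq.sum {ι : Type*} {s : Finset ι} {f : ι → ℕ → Fock}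
    (hf : ∀ i ∈ s, NegligibleSeq (f i)) : NegligibleSeq fun M => ∑ i ∈ s, f i M := by
  classical
  induction s using Finset.induction_on with
  | empty => simpa using negligibleSeq_zero
  | insert i s hi ih =>
    simp only [Finset.sum_insert hi]
    exact (hf i (by simp)).add (ih fun j hj => hf j (by simp [hj]))

lemma NegligibleSeq.monodromy {f : ℕ → Fock} (hf : NegligibleSeq f) (t : ℂ) {x : ℂ}
    (hx : ‖x‖ < 1) (a : Fin 2) : NegligibleSeq fun M => monodromy t x M a 1 (f M) := by
  obtain ⟨⟨n, hn⟩, hf⟩ := hf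
  obtain ⟨K, hK⟩ := exists_monodromy_bound t (r := 1) le_rfl (by simpa using hx) n
  exact negligibleSeq_of_le (fun M => (shifts_monodromy t x M a 1).apply_mem_sector (hn M))
    (by simpa using hf.const_mul K) fun M => (hK M a _ (hn M)).2

lemma NegligibleSeq.dualMonodromy {f : ℕ → Fock} (hf : NegligibleSeq f) (t : ℂ) {x : ℂ}
    (hx : ‖x‖ < 1) (a : Fin 2) : NegligibleSeq fun M => dualMonodromy t x M a 0 (f M) := by
  obtain ⟨⟨n, hn⟩, hf⟩ := hf
  obtain ⟨K, hK⟩ := exists_dualMonodromy_bound t hx n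
  exact negligibleSeq_of_le
    (fun M => (shifts_dualMonodromy t x M a 0).apply_mem_sector (hn M))
    (by simpa using hf.const_mul K) fun M => hK M a _ (hn M)

lemma NegligibleSeq.tendsto_evenCovector {f : ℕ → Fock} (hf : NegligibleSeq f) (t : ℂ) :
    Tendsto (fun M => evenCovector t (f M)) atTop (𝓝 0) := by
  obtain ⟨⟨n, hn⟩, hf⟩ := hf
  exact squeeze_zero_norm (fun M => norm_evenCovector_le t (hn M))
    (by simpa using hf.const_mul (((1 + ‖t‖) ^ n) ^ n))

lemma BoundedSeq.monodromy {r : ℝ} {f : ℕ → Fock} (hf : BoundedSeq r f) (t : ℂ) {x : ℂ}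
    (hr : 1 ≤ r) (hx : r * ‖x‖ < 1) (a : Fin 2) :
    BoundedSeq r fun M => monodromy t x M a 1 (f M) := by
  obtain ⟨n, B, hB⟩ := hf
  obtain ⟨K, hK⟩ := exists_monodromy_bound t hr hx n
  refine ⟨n + 1, |K| * B, fun M =>
    ⟨(shifts_monodromy t x M a 1).apply_mem_sector (hB M).1, (hK M a _ (hB M).1).2.trans ?_⟩⟩
  have h0 := fockNorm_nonneg (zero_le_one.trans hr) (f M)
  exact mul_le_mul (le_abs_self K) (hB M).2 h0 (abs_nonneg K)

/-- The slack r > 1 gives the decay r^(-M), and the weighted norm dominates the unweighted one in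
which the result is measured. -/
lemma BoundedSeq.negligibleSeq_monodromy {r : ℝ} {f : ℕ → Fock} (hf : BoundedSeq r f) (t : ℂ)
    {x : ℂ} (hr : 1 < r) (hx : r * ‖x‖ < 1) (a : Fin 2) :
    NegligibleSeq fun M => ReflectingLittlewood.monodromy t x M a 0 (f M) := by
  obtain ⟨n, B, hB⟩ := hf
  obtain ⟨K, hK⟩ := exists_monodromy_bound t hr.le hx n
  have hr0 : 0 < r := by linarith
  refine negligibleSeq_of_le (n := n + 0) (u := fun M => |K| * B * r⁻¹ ^ M)
    (fun M => (shifts_monodromy t x M a 0).apply_mem_sector (hB M).1)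
    (by simpa using (tendsto_pow_atTop_nhds_zero_of_lt_one (by positivity)
      (inv_lt_one_of_one_lt₀ hr)).const_mul (|K| * B)) fun M => ?_
  refine (fockNorm_mono zero_le_one hr.le _).trans ?_
  rw [inv_pow, ← div_eq_mul_inv, le_div_iff₀ (by positivity), mul_comm]
  refine (hK M a _ (hB M).1).1.trans ?_
  exact mul_le_mul (le_abs_self K) (hB M).2 (fockNorm_nonneg hr0.le _) (abs_nonneg K)

/-! ### Products of rows and their reflection -/

lemma sum_snoc {R : Type*} [AddCommMonoid R] {N : ℕ} (F : (Fin (N + 1) → Fin 2) → R) :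
    ∑ a, F a = ∑ c : Fin 2, ∑ b : Fin N → Fin 2, F (Fin.snoc (α := fun _ => Fin 2) b c) := by
  rw [← (Fin.snocEquiv fun _ : Fin (N + 1) => Fin 2).sum_comp, Fintype.sum_prod_type]
  rfl

/-- The state obtained from the vacuum by the rows on `M` sites with parameters `v`, left edges in
the states `a` and right edges in the state `1`. -/
def rowState (t : ℂ) (M : ℕ) : (N : ℕ) → (Fin N → ℂ) → (Fin N → Fin 2) → Fock
  | 0, _, _ => vacuum
  | N + 1, v, a => monodromy t (v (Fin.last N)) M (a (Fin.last N)) 1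
      (rowState t M N (fun i => v i.castSucc) fun i => a i.castSucc)

/-- The weight of a column which crosses rows whose left edges are in the states `a` and whose right
edges are in the states `b`; it enters at the bottom in the state `c.rev` and leaves in the state
`0`. -/
def columnWeight (t w : ℂ) : (N : ℕ) → Fin 2 → (Fin N → ℂ) → (Fin N → Fin 2) → (Fin N → Fin 2) → ℂ
  | 0, c, _, _, _ => if c = 1 then 1 else 0
  | N + 1, c, v, a, b => ∑ c' : Fin 2,
      rWeight t (w * v (Fin.last N)) (a (Fin.last N)) c.rev (b (Fin.last N)) c'.rev *
        columnWeight t w N c' (fun i => v i.castSucc) (fun i => a i.castSucc) fun i => b i.castSucc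

/-- The limit of the pairing of the boundary covector with a product of rows. -/
def rowLimit (t : ℂ) : (N : ℕ) → (Fin N → ℂ) → (Fin N → Fin 2) → ℂ
  | 0, _, _ => 1
  | N + 1, v, a => ∑ b : Fin N → Fin 2,
      columnWeight t (v (Fin.last N)) N (a (Fin.last N)) (fun i => v i.castSucc)
        (fun i => a i.castSucc) b * rowLimit t N (fun i => v i.castSucc) b

lemma boundedSeq_rowState (t : ℂ) {r : ℝ} (hr : 1 ≤ r) {N : ℕ} {v : Fin N → ℂ}
    (hv : ∀ i, r * ‖v i‖ < 1) (a : Fin N → Fin 2) : BoundedSeq r fun M => rowState t M N v a := by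
  induction N with
  | zero =>
    refine ⟨0, 1, fun M => ⟨mem_sector.2 fun lam h => ?_, ?_⟩⟩
    · have := Finset.mem_singleton.1 (Finsupp.support_single_subset h)
      simp [this, numParts]
    · simp [rowState, vacuum, fockNorm_single, weight]
  | succ N ih => exact (ih (fun i => hv i.castSucc) _).monodromy t hr (hv _) _

lemma exists_one_lt_mul_lt {N : ℕ} {v : Fin N → ℂ} (hv : ∀ i, ‖v i‖ < 1) :
    ∃ r : ℝ, 1 < r ∧ ∀ i, r * ‖v i‖ < 1 := by
  have h : ∀ᶠ r : ℝ in 𝓝[>] 1, ∀ i, r * ‖v i‖ < 1 := eventually_all.2 fun i => by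
    have : Tendsto (fun r : ℝ => r * ‖v i‖) (𝓝[>] 1) (𝓝 (1 * ‖v i‖)) :=
      (tendsto_id.mul_const _).mono_left nhdsWithin_le_nhds
    exact this.eventually_lt_const (by simpa using hv i)
  obtain ⟨r, hr, hr1⟩ := (h.and self_mem_nhdsWithin).exists
  exact ⟨r, hr1, hr⟩

lemma mul_ne_one_of_norm_lt_one {x y : ℂ} (hx : ‖x‖ < 1) (hy : ‖y‖ < 1) : y * x ≠ 1 := fun h => by
  have := congrArg norm h
  rw [norm_mul, norm_one] at this
  nlinarith [norm_nonneg x, norm_nonneg y]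

/-- A flipped row may be moved through a product of rows, up to a negligible error. -/
lemma negligibleSeq_dualMonodromy_rowState (t : ℂ) {w : ℂ} (hw : ‖w‖ < 1) {N : ℕ} {v : Fin N → ℂ}
    (hv : ∀ i, ‖v i‖ < 1) (c : Fin 2) (a : Fin N → Fin 2) :
    NegligibleSeq fun M => dualMonodromy t w M c 1 (rowState t M N v a) -
      ∑ b, columnWeight t w N c v a b • rowState t M N v b := by
  induction N generalizing c with
  | zero =>
    convert negligibleSeq_zero using 2 with M
    obtain ⟨h0, h1⟩ := dualMonodromy_vacuum t w M
    fin_cases c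
    · simpa [rowState, columnWeight] using h0
    · simpa [rowState, columnWeight, sub_eq_zero] using h1
  | succ N ih =>
    set v' : Fin N → ℂ := fun i => v i.castSucc
    set a' : Fin N → Fin 2 := fun i => a i.castSucc
    set x := v (Fin.last N)
    set a₁ := a (Fin.last N)
    have hx : ‖x‖ < 1 := hv _
    obtain ⟨r, hr1, hr⟩ := exists_one_lt_mul_lt hv
    -- The extra term of the exchange: the ordinary row ending in a hole makes it small, and the
    -- dual row ending in a hole keeps it small.
    have hrest := ((((boundedSeq_rowState t hr1.le (fun i => hr i.castSucc) a').negligibleSeq_monodromy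
      t hr1 (hr (Fin.last N)) a₁).dualMonodromy t hw c).smul ((1 - t) * (w * x) / (1 - w * x))).smul (-1)
    -- The error made in the remaining N rows stays negligible under the row that has just been
    -- crossed.
    have hmain : NegligibleSeq fun M => ∑ c' : Fin 2, ∑ d : Fin 2,
        rWeight t (w * x) a₁ c.rev d c'.rev • monodromy t x M d 1
          (dualMonodromy t w M c' 1 (rowState t M N v' a') -
            ∑ b, columnWeight t w N c' v' a' b • rowState t M N v' b) :=
      NegligibleSeq.sum fun c' _ => NegligibleSeq.sum fun d _ =>
        ((ih (fun i => hv i.castSucc) c' a').monodromy t hx d).smul _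
    convert hmain.add hrest using 2 with M
    have hex := LinearMap.congr_fun
      (dualMonodromy_mul_monodromy t (mul_ne_one_of_norm_lt_one hx hw) M c a₁) (rowState t M N v' a')
    simp only [LinearMap.sub_apply, Module.End.mul_apply, LinearMap.smul_apply,
      LinearMap.sum_apply] at hex
    rw [rowState, hex, sum_snoc]
    simp only [rowState, columnWeight, Fin.snoc_last, Fin.snoc_castSucc, map_sub, map_sum, map_smul,
      smul_sub, Finset.sum_sub_distrib, Finset.smul_sum, Finset.sum_smul, smul_smul]
    have hswap : ∀ F : Fin 2 → (Fin N → Fin 2) → Fin 2 → Fock,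
        ∑ d, ∑ b, ∑ c', F d b c' = ∑ c', ∑ d, ∑ b, F d b c' := fun F =>
      (Finset.sum_congr rfl fun d _ => Finset.sum_comm).trans Finset.sum_comm
    rw [hswap, neg_one_mul, neg_smul, ← sub_eq_add_neg]
    exact sub_right_comm _ _ _

/-- Reflecting the last row and moving it down to the vacuum turns it into a column, leaving the
same pairing with one row fewer. -/
lemma tendsto_evenCovector_rowState (t : ℂ) {N : ℕ} {v : Fin N → ℂ} (hv : ∀ i, ‖v i‖ < 1)
    (a : Fin N → Fin 2) :
    Tendsto (fun M => evenCovector t (rowState t M N v a)) atTop (𝓝 (rowLimit t N v a)) := by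
  induction N with
  | zero =>
    classical
    have : ∀ M, evenCovector t (rowState t M 0 v a) = rowLimit t 0 v a := fun M => by
      simp [rowState, rowLimit, vacuum, evenCovector_single, evenCoeff]
    simp only [this, tendsto_const_nhds]
  | succ N ih =>
    have h1 := (negligibleSeq_dualMonodromy_rowState t (hv (Fin.last N)) (fun i => hv i.castSucc)
      (a (Fin.last N)) fun i => a i.castSucc).tendsto_evenCovector t
    have h2 : Tendsto (fun M => ∑ b : Fin N → Fin 2,
        columnWeight t (v (Fin.last N)) N (a (Fin.last N)) (fun i => v i.castSucc)
          (fun i => a i.castSucc) b * evenCovector t (rowState t M N (fun i => v i.castSucc) b))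
        atTop (𝓝 (rowLimit t (N + 1) v a)) :=
      tendsto_finsetSum _ fun b _ => (ih (fun i => hv i.castSucc) b).const_mul _
    have h3 := h1.add h2
    rw [zero_add] at h3
    refine h3.congr fun M => ?_
    simp only [map_sub, map_sum, map_smul, smul_eq_mul, sub_add_cancel]
    exact (LinearMap.congr_fun (evenCovector_monodromy t _ M _ _) _).symm

/-! ### The partition function -/

/-- The partition function on `N` lines with parameters `v`, whose left ends are in the states
`a`. -/
def gridSum (t : ℂ) (N : ℕ) (v : Fin N → ℂ) (a : Fin N → Fin 2) : ℂ :=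
  ∑ h : Edge N → Fin 2, ∑ u : Edge N → Fin 2,
    if (∀ k, h (leftmostEdge k) = a k) ∧ (∀ k, u (uppermostEdge k) = 0) ∧
        (∀ k, u (diagonalEdge k) = (h (diagonalEdge k)).rev) then
      ∏ p : Vertex N, rWeight t (v p.1.2 * v p.1.1) (h p.here) (u p.below) (h p.toRight) (u p.here)
    else 0

lemma columnWeight_eq_sum (t w : ℂ) {N : ℕ} (c : Fin 2) (v : Fin N → ℂ) (a b : Fin N → Fin 2) :
    columnWeight t w N c v a b = ∑ u : Fin (N + 1) → Fin 2,
      if u 0 = 0 ∧ u (Fin.last N) = c.rev then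
        ∏ j : Fin N, rWeight t (w * v j) (a j) (u j.succ) (b j) (u j.castSucc)
      else 0 := by
  induction N generalizing c with
  | zero =>
    rw [sum_snoc]
    have hempty : ({x | x = 0 ∧ x = 1} : Finset (Fin 2)) = ∅ := by decide
    fin_cases c <;> simp [columnWeight, Fin.snoc, Fin.rev, hempty]
  | succ N ih =>
    rw [sum_snoc, columnWeight]
    have hz : ∀ (u : Fin (N + 1) → Fin 2) (d : Fin 2),
        (Fin.snoc (α := fun _ => Fin 2) u d : Fin (N + 2) → Fin 2) 0 = u 0 := fun u d => by
      rw [← Fin.castSucc_zero, Fin.snoc_castSucc]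
    simp only [Fin.snoc_last, hz, Fin.prod_univ_castSucc, Fin.snoc_castSucc, Fin.succ_castSucc,
      Fin.succ_last, ih, Finset.mul_sum]
    rw [Finset.sum_comm, Finset.sum_comm (γ := Fin 2)]
    refine Finset.sum_congr rfl fun u _ => ?_
    rw [Finset.sum_eq_single (u (Fin.last N)).rev, Finset.sum_eq_single c.rev]
    · simp [mul_comm]
    · intro d _ hd
      simp [hd]
    · simp
    · intro d _ hd
      rw [if_neg, mul_zero]
      rintro ⟨-, h⟩
      exact hd (by rw [h, Fin.rev_rev])
    · simp

/-- The edges of `N + 1` lines are those of the first `N` lines and those to the left of the last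
column or on it. -/
def edgeEquiv (N : ℕ) : Edge N ⊕ Fin (N + 1) ≃ Edge (N + 1) :=
  Equiv.ofBijective
    (Sum.elim (fun e => ⟨(e.1.1.castSucc, e.1.2.castSucc), e.2⟩) fun j => ⟨(j, Fin.last N), Fin.le_last j⟩) <| by
    constructor
    · rintro (⟨⟨i, j⟩, h⟩ | i) (⟨⟨i', j'⟩, h'⟩ | i') h
      · simpa using h
      · simp at h
      · simp at h
        exact absurd h.2.symm (Fin.castSucc_lt_last _).ne
      · simpa using h
    · rintro ⟨⟨i, j⟩, h⟩
      induction j using Fin.lastCases with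
      | last => exact ⟨Sum.inr i, rfl⟩
      | cast j =>
        have hi : (i : ℕ) < N := lt_of_le_of_lt (Fin.le_def.1 h) j.isLt
        exact ⟨Sum.inl ⟨(⟨i, hi⟩, j), h⟩, rfl⟩

/-- The vertices of `N + 1` lines are those of the first `N` lines and those on the last column. -/
def vertexEquiv (N : ℕ) : Vertex N ⊕ Fin N ≃ Vertex (N + 1) :=
  Equiv.ofBijective
    (Sum.elim (fun p => ⟨(p.1.1.castSucc, p.1.2.castSucc), p.2⟩)
      fun j => ⟨(j.castSucc, Fin.last N), Fin.castSucc_lt_last j⟩) <| by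
    constructor
    · rintro (⟨⟨i, j⟩, h⟩ | i) (⟨⟨i', j'⟩, h'⟩ | i') h
      · simpa using h
      · simp at h
      · simp at h
        exact absurd h.2.symm (Fin.castSucc_lt_last _).ne
      · simpa using h
    · rintro ⟨⟨i, j⟩, h⟩
      induction j using Fin.lastCases with
      | last => exact ⟨Sum.inr ⟨i, Fin.lt_def.1 h⟩, rfl⟩
      | cast j =>
        have hi : (i : ℕ) < N := (Fin.lt_def.1 h).trans j.isLt
        exact ⟨Sum.inl ⟨(⟨i, hi⟩, j), h⟩, rfl⟩

lemma edgeEquiv_leftmost {N : ℕ} (j : Fin (N + 1)) :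
    leftmostEdge j = edgeEquiv N (Sum.inr j) := rfl

lemma edgeEquiv_uppermost_castSucc {N : ℕ} (k : Fin N) :
    uppermostEdge k.castSucc = edgeEquiv N (Sum.inl (uppermostEdge k)) := rfl

lemma edgeEquiv_uppermost_last {N : ℕ} :
    uppermostEdge (Fin.last N) = edgeEquiv N (Sum.inr 0) := rfl

lemma edgeEquiv_diagonal_castSucc {N : ℕ} (k : Fin N) :
    diagonalEdge k.castSucc = edgeEquiv N (Sum.inl (diagonalEdge k)) := rfl

lemma edgeEquiv_diagonal_last {N : ℕ} :
    diagonalEdge (Fin.last N) = edgeEquiv N (Sum.inr (Fin.last N)) := rfl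

lemma here_inl {N : ℕ} (p : Vertex N) :
    (vertexEquiv N (Sum.inl p)).here = edgeEquiv N (Sum.inl p.here) := rfl

lemma below_inl {N : ℕ} (p : Vertex N) :
    (vertexEquiv N (Sum.inl p)).below = edgeEquiv N (Sum.inl p.below) := rfl

lemma toRight_inl {N : ℕ} (p : Vertex N) :
    (vertexEquiv N (Sum.inl p)).toRight = edgeEquiv N (Sum.inl p.toRight) := rfl

lemma here_inr {N : ℕ} (j : Fin N) :
    (vertexEquiv N (Sum.inr j)).here = edgeEquiv N (Sum.inr j.castSucc) := rfl

lemma below_inr {N : ℕ} (j : Fin N) :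
    (vertexEquiv N (Sum.inr j)).below = edgeEquiv N (Sum.inr j.succ) := rfl

lemma toRight_inr {N : ℕ} (j : Fin N) :
    (vertexEquiv N (Sum.inr j)).toRight = edgeEquiv N (Sum.inl (leftmostEdge j)) := rfl

lemma sum_edge_states {N : ℕ} (F : (Edge (N + 1) → Fin 2) → ℂ) :
    ∑ h, F h = ∑ h₁ : Edge N → Fin 2, ∑ h₂ : Fin (N + 1) → Fin 2,
      F (Sum.elim h₁ h₂ ∘ (edgeEquiv N).symm) := by
  rw [← Fintype.sum_prod_type' (f := fun h₁ h₂ => F (Sum.elim h₁ h₂ ∘ (edgeEquiv N).symm)),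
    ← (((Equiv.sumArrowEquivProdArrow _ _ _).symm.trans
      ((edgeEquiv N).arrowCongr (Equiv.refl (Fin 2))))).sum_comp]
  rfl

/-- The last line has no vertex on its row and turns at once into the leftmost column. Removing this
column exposes the edges to its right as the left ends `b` of the remaining rows. -/
lemma gridSum_succ (t : ℂ) {N : ℕ} (v : Fin (N + 1) → ℂ) (a : Fin (N + 1) → Fin 2) :
    gridSum t (N + 1) v a = ∑ b : Fin N → Fin 2,
      columnWeight t (v (Fin.last N)) N (a (Fin.last N)) (fun i => v i.castSucc)
        (fun i => a i.castSucc) b * gridSum t N (fun i => v i.castSucc) b := by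
  have hterm : ∀ (h₁ u₁ : Edge N → Fin 2),
      (∑ h₂ : Fin (N + 1) → Fin 2, ∑ u₂ : Fin (N + 1) → Fin 2,
        if (∀ k, (Sum.elim h₁ h₂ ∘ (edgeEquiv N).symm) (leftmostEdge k) = a k) ∧
            (∀ k, (Sum.elim u₁ u₂ ∘ (edgeEquiv N).symm) (uppermostEdge k) = 0) ∧
            (∀ k, (Sum.elim u₁ u₂ ∘ (edgeEquiv N).symm) (diagonalEdge k) =
              ((Sum.elim h₁ h₂ ∘ (edgeEquiv N).symm) (diagonalEdge k)).rev) then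
          ∏ p : Vertex (N + 1), rWeight t (v p.1.2 * v p.1.1)
            ((Sum.elim h₁ h₂ ∘ (edgeEquiv N).symm) p.here)
            ((Sum.elim u₁ u₂ ∘ (edgeEquiv N).symm) p.below)
            ((Sum.elim h₁ h₂ ∘ (edgeEquiv N).symm) p.toRight)
            ((Sum.elim u₁ u₂ ∘ (edgeEquiv N).symm) p.here)
        else 0) =
      columnWeight t (v (Fin.last N)) N (a (Fin.last N)) (fun i => v i.castSucc)
        (fun i => a i.castSucc) (fun k => h₁ (leftmostEdge k)) *
      if (∀ k, u₁ (uppermostEdge k) = 0) ∧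
          (∀ k, u₁ (diagonalEdge k) = (h₁ (diagonalEdge k)).rev) then
        ∏ p : Vertex N, rWeight t (v p.1.2.castSucc * v p.1.1.castSucc)
          (h₁ p.here) (u₁ p.below) (h₁ p.toRight) (u₁ p.here)
      else 0 := by
    intro h₁ u₁
    have hv1 : ∀ p : Vertex N, (vertexEquiv N (Sum.inl p)).1 =
      (p.1.1.castSucc, p.1.2.castSucc) := fun _ => rfl
    have hv2 : ∀ j : Fin N, (vertexEquiv N (Sum.inr j)).1 =
      (j.castSucc, Fin.last N) := fun _ => rfl
    -- The new horizontal edges are exactly the left ends, so they are fixed to be `a`; only the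
    -- vertical edges of the new column are summed over.
    rw [columnWeight_eq_sum, Finset.sum_eq_single a, Finset.sum_mul]
    · refine Finset.sum_congr rfl fun u₂ _ => ?_
      simp only [← (vertexEquiv N).prod_comp, Fintype.prod_sum_type, here_inl, below_inl,
        toRight_inl, here_inr, below_inr, toRight_inr, hv1, hv2, edgeEquiv_leftmost,
        Function.comp_apply, Equiv.symm_apply_apply, Sum.elim_inl, Sum.elim_inr,
        Fin.forall_fin_succ', edgeEquiv_uppermost_castSucc, edgeEquiv_uppermost_last,
        edgeEquiv_diagonal_castSucc, edgeEquiv_diagonal_last, implies_true, true_and]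
      by_cases h1 : u₂ 0 = 0 ∧ u₂ (Fin.last N) = (a (Fin.last N)).rev <;>
      by_cases h2 : (∀ k, u₁ (uppermostEdge k) = 0) ∧
          (∀ k, u₁ (diagonalEdge k) = (h₁ (diagonalEdge k)).rev)
      · rw [if_pos ⟨⟨h2.1, h1.1⟩, h2.2, h1.2⟩, if_pos h1, if_pos h2, mul_comm]
      · rw [if_neg (fun h => h2 ⟨h.1.1, h.2.1⟩), if_neg h2, mul_zero]
      · rw [if_neg (fun h => h1 ⟨h.1.2, h.2.2⟩), if_neg h1, zero_mul]
      · rw [if_neg (fun h => h2 ⟨h.1.1, h.2.1⟩), if_neg h2, mul_zero]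
    · intro h₂ _ hne
      refine Finset.sum_eq_zero fun u₂ _ => if_neg fun h => hne (funext fun k => ?_)
      simpa [edgeEquiv_leftmost] using h.1 k
    · simp
  rw [gridSum, sum_edge_states]
  simp only [sum_edge_states (N := N)]
  refine (Finset.sum_congr rfl fun h₁ _ =>
    Finset.sum_comm.trans (Finset.sum_congr rfl fun u₁ _ => hterm h₁ u₁)).trans ?_
  simp only [gridSum, Finset.mul_sum]
  rw [Finset.sum_comm (γ := Fin N → Fin 2)]
  refine Finset.sum_congr rfl fun h₁ _ => ?_
  rw [Finset.sum_comm (γ := Fin N → Fin 2)]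
  refine Finset.sum_congr rfl fun u₁ _ => ?_
  rw [Finset.sum_eq_single fun k => h₁ (leftmostEdge k)]
  · simp
  · intro b _ hb
    rw [if_neg, mul_zero]
    exact fun h => hb (funext fun k => (h.1 k).symm)
  · simp

lemma gridSum_eq_rowLimit (t : ℂ) {N : ℕ} (v : Fin N → ℂ) (a : Fin N → Fin 2) :
    gridSum t N v a = rowLimit t N v a := by
  induction N with
  | zero => simp [gridSum, rowLimit]
  | succ N ih =>
    rw [gridSum_succ, rowLimit]
    simp only [ih]

lemma partitionFunctionUO_eq_sum {m : ℕ} (t q : ℂ) (x : Fin m → ℂ) :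
    partitionFunctionUO t (q ^ 2) x = ∑ a : Fin (2 * m) → Fin 2,
      (∏ i : Fin m, uTurn t (a ⟨2 * (i : ℕ), by omega⟩) (a ⟨2 * (i : ℕ) + 1, by omega⟩)) *
        rowLimit t (2 * m) (fun j => q * lineParameter x j) a := by
  simp only [← gridSum_eq_rowLimit, gridSum, partitionFunctionUO, Finset.mul_sum]
  rw [Finset.sum_comm (γ := Fin (2 * m) → Fin 2)]
  refine Finset.sum_congr rfl fun h _ => ?_
  rw [Finset.sum_comm (γ := Fin (2 * m) → Fin 2)]
  refine Finset.sum_congr rfl fun u _ => ?_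
  rw [Finset.sum_eq_single fun k => h (leftmostEdge k)]
  · simp only [implies_true, true_and]
    split_ifs
    · congr 1
      refine Finset.prod_congr rfl fun p _ => ?_
      congr 1
      ring
    · simp
  · intro b _ hb
    rw [if_neg, mul_zero]
    exact fun h => hb (funext fun k => (h.1 k).symm)
  · simp

/-! ### Matrix elements of the monodromy matrix -/

/-- The product of the matrix elements of the `L` matrices at the sites `0, …, M - 1`. -/
def siteProd (t x : ℂ) (M : ℕ) (lam mu : PartState) : Matrix (Fin 2) (Fin 2) ℂ :=
  ((List.range M).map fun i => lMatrix t x (lam i) (mu i)).prod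

lemma siteProd_succ (t x : ℂ) (M : ℕ) (lam mu : PartState) :
    siteProd t x (M + 1) lam mu = siteProd t x M lam mu * lMatrix t x (lam M) (mu M) := by
  simp [siteProd, List.range_succ]

lemma siteProd_congr (t x : ℂ) {M : ℕ} (lam : PartState) {mu nu : PartState}
    (h : ∀ i < M, mu i = nu i) : siteProd t x M lam mu = siteProd t x M lam nu := by
  unfold siteProd
  congr 1
  refine List.map_congr_left fun i hi => ?_
  rw [h i (List.mem_range.1 hi)]

lemma forall_ge_succ_iff {M : ℕ} {p : ℕ → Prop} : (∀ i ≥ M, p i) ↔ p M ∧ ∀ i ≥ M + 1, p i :=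
  ⟨fun h => ⟨h M le_rfl, fun i hi => h i (by omega)⟩, fun h i hi => by
    rcases eq_or_lt_of_le hi with rfl | hi
    exacts [h.1, h.2 i hi]⟩

lemma monodromy_zero_succ_single (t x : ℂ) (M : ℕ) (a : Fin 2) (mu : PartState) :
    monodromy t x (M + 1) a 0 (Finsupp.single mu 1) =
      x • monodromy t x M a 0 (Finsupp.single mu 1) +
      (1 - t ^ mu M) • monodromy t x M a 1 (Finsupp.single (mu - Finsupp.single M 1) 1) := by
  simp only [monodromy, Matrix.mul_apply, Fin.sum_univ_two, LinearMap.add_apply,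
    Module.End.mul_apply, siteL, Matrix.of_apply, Matrix.cons_val', Matrix.cons_val_zero,
    Matrix.cons_val_one, Matrix.cons_val_fin_one, LinearMap.smul_apply, Module.End.one_apply,
    map_smul, annihilation_single]

lemma monodromy_one_succ_single (t x : ℂ) (M : ℕ) (a : Fin 2) (mu : PartState) :
    monodromy t x (M + 1) a 1 (Finsupp.single mu 1) =
      x • monodromy t x M a 0 (Finsupp.single (mu + Finsupp.single M 1) 1) +
      monodromy t x M a 1 (Finsupp.single mu 1) := by
  simp only [monodromy, Matrix.mul_apply, Fin.sum_univ_two, LinearMap.add_apply,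
    Module.End.mul_apply, siteL, Matrix.of_apply, Matrix.cons_val', Matrix.cons_val_zero,
    Matrix.cons_val_one, Matrix.cons_val_fin_one, LinearMap.smul_apply, Module.End.one_apply,
    map_smul, creation_single]

-- This links operators to the matrix products of the definitions: the operator on M sites leaves
-- all later occupations unchanged.
open scoped Classical in
lemma monodromy_single_apply (t x : ℂ) (M : ℕ) (a b : Fin 2) (lam mu : PartState) :
    monodromy t x M a b (Finsupp.single mu 1) lam =
      if ∀ i ≥ M, lam i = mu i then siteProd t x M lam mu a b else 0 := by
  induction M generalizing b mu with
  | zero =>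
    have : (∀ i ≥ 0, lam i = mu i) ↔ mu = lam := by
      simp [Finsupp.ext_iff, eq_comm]
    rw [this]
    rcases eq_or_ne a b with rfl | h
    · simp [monodromy, siteProd, Finsupp.single_apply]
    · simp [monodromy, siteProd, Matrix.one_apply_ne h]
  | succ M ih =>
    rw [siteProd_succ, Matrix.mul_apply, Fin.sum_univ_two]
    have hsub : ∀ i ≥ M + 1, (mu - Finsupp.single M 1 : PartState) i = mu i := fun i hi => by
      simp [show i ≠ M by omega]
    have hadd : ∀ i ≥ M + 1, (mu + Finsupp.single M 1 : PartState) i = mu i := fun i hi => by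
      simp [show i ≠ M by omega]
    have hsub' : siteProd t x M lam (mu - Finsupp.single M 1) = siteProd t x M lam mu :=
      siteProd_congr t x lam fun i hi => by simp [hi.ne]
    have hadd' : siteProd t x M lam (mu + Finsupp.single M 1) = siteProd t x M lam mu :=
      siteProd_congr t x lam fun i hi => by simp [hi.ne]
    obtain rfl | rfl : b = 0 ∨ b = 1 := by fin_cases b <;> simp
    · rw [monodromy_zero_succ_single, Finsupp.add_apply, Finsupp.smul_apply, Finsupp.smul_apply,
        ih, ih, forall_ge_succ_iff, forall_ge_succ_iff (p := fun i => lam i = (mu - _ : PartState) i),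
        hsub']
      by_cases htail : ∀ i ≥ M + 1, lam i = mu i
      · have htail' : ∀ i ≥ M + 1, lam i = (mu - Finsupp.single M 1 : PartState) i := fun i hi => by
          rw [htail i hi, hsub i hi]
        simp only [eq_true htail, eq_true htail', and_true, if_true, lMatrix]
        -- At an empty site `mu M - 1` is 0, so the condition on `lam M` differs from that in
        -- `lMatrix`, but the coefficient `1 - t ^ 0` vanishes.
        by_cases hm : mu M = 0
        · simp [hm, mul_comm]
        · have : lam M = mu M - 1 ↔ lam M + 1 = mu M := by omega
          simp [this, mul_comm]
      · have htail' : ¬ ∀ i ≥ M + 1, lam i = (mu - Finsupp.single M 1 : PartState) i := fun h =>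
          htail fun i hi => by rw [h i hi, hsub i hi]
        simp only [htail, htail', and_false, if_false, smul_zero, add_zero]
    · rw [monodromy_one_succ_single, Finsupp.add_apply, Finsupp.smul_apply,
        ih, ih, forall_ge_succ_iff, forall_ge_succ_iff (p := fun i => lam i = mu i),
        hadd']
      by_cases htail : ∀ i ≥ M + 1, lam i = mu i
      · have htail' : ∀ i ≥ M + 1, lam i = (mu + Finsupp.single M 1 : PartState) i := fun i hi => by
          rw [htail i hi, hadd i hi]
        simp only [eq_true htail, eq_true htail', and_true, if_true, lMatrix]
        simp [mul_comm]
      · have htail' : ¬ ∀ i ≥ M + 1, lam i = (mu + Finsupp.single M 1 : PartState) i := fun h =>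
          htail fun i hi => by rw [h i hi, hadd i hi]
        simp only [htail, htail', and_false, if_false, smul_zero, add_zero]

lemma eq_of_monodromy_single_apply_ne_zero {t x : ℂ} {M : ℕ} {a b : Fin 2} {lam mu : PartState}
    (h : monodromy t x M a b (Finsupp.single mu 1) lam ≠ 0) {i : ℕ} (hi : M ≤ i) :
    lam i = mu i := by
  classical
  rw [monodromy_single_apply] at h
  split_ifs at h with hc
  · exact hc i hi
  · exact absurd rfl h

lemma siteProd_one_of_le (t x : ℂ) {K K' : ℕ} (hK : K ≤ K') {lam mu : PartState}
    (hlam : ∀ i ≥ K, lam i = 0) (hmu : ∀ i ≥ K, mu i = 0) (a : Fin 2) :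
    siteProd t x K' lam mu a 1 = siteProd t x K lam mu a 1 := by
  induction K', hK using Nat.le_induction with
  | base => rfl
  | succ K' hK ih =>
    rw [siteProd_succ, Matrix.mul_apply, Fin.sum_univ_two, ← ih]
    simp [lMatrix, hlam K' hK, hmu K' hK]

/-- A row that removes a particle at site k leaves that site as a hole, and could become a particle
again only by creating one further right, where `lam` is empty. -/
lemma siteProd_one_eq_zero (t x : ℂ) {M K : ℕ} {lam mu : PartState}
    (hlam : ∀ i ≥ M, lam i = 0) {k : ℕ} (hMk : M ≤ k) (hkK : k < K) (hk : mu k ≠ 0) (a : Fin 2) :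
    siteProd t x K lam mu a 1 = 0 := by
  induction K, hkK using Nat.le_induction with
  | base =>
    rw [siteProd_succ, Matrix.mul_apply, Fin.sum_univ_two]
    simp [lMatrix, hlam k hMk, hk.symm]
  | succ K hK ih =>
    rw [siteProd_succ, Matrix.mul_apply, Fin.sum_univ_two, ih]
    simp [lMatrix, hlam K (by omega)]

lemma eq_zero_of_cutoff_le {lam mu : PartState} {i : ℕ} (h : cutoff lam mu ≤ i) :
    lam i = 0 ∧ mu i = 0 := by
  have hi : i ∉ lam.support ∪ mu.support := fun hi => by
    have : i ≤ (lam.support ∪ mu.support).sup id := Finset.le_sup (f := id) hi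
    unfold cutoff at h
    omega
  simpa [not_or] using hi

/-- Emptiness of the final state alone suffices: an initial particle at a site ≥ M makes both sides
vanish, and otherwise the sites beyond M contribute nothing. -/
lemma siteProd_cutoff (t x : ℂ) {M : ℕ} {lam mu : PartState} (hlam : ∀ i ≥ M, lam i = 0)
    (a : Fin 2) :
    siteProd t x (cutoff lam mu) lam mu a 1 =
      monodromy t x M a 1 (Finsupp.single mu 1) lam := by
  classical
  rw [monodromy_single_apply]
  have hc : ∀ i ≥ cutoff lam mu, lam i = 0 := fun i hi => (eq_zero_of_cutoff_le hi).1
  have hc' : ∀ i ≥ cutoff lam mu, mu i = 0 := fun i hi => (eq_zero_of_cutoff_le hi).2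
  rw [← siteProd_one_of_le t x (le_max_left (cutoff lam mu) M) hc hc']
  split_ifs with h
  · exact siteProd_one_of_le t x (le_max_right _ _) hlam (fun i hi => by rw [← h i hi, hlam i hi]) a
  · push Not at h
    obtain ⟨k, hk, hne⟩ := h
    have hmk : mu k ≠ 0 := fun h0 => hne (by rw [hlam k hk, h0])
    refine siteProd_one_eq_zero t x hlam hk ?_ hmk a
    by_contra! hle
    exact hmk (hc' k ((le_max_left _ _).trans hle))

/-! ### Boundary sites -/

lemma bMatrix_zero_zero (t x : ℂ) : bMatrix t 0 x 0 0 = 1 := by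
  simp [bMatrix, Matrix.one_fin_two]

/-- Creation on a boundary site carries the boundary parameter, here 0, so the boundary sites stay
empty and drop out. -/
lemma bMatrix_succ_zero (t x : ℂ) {k : ℕ} (hk : k ≠ 0) : bMatrix t 0 x k 0 = 0 := by
  ext a b
  fin_cases a <;> fin_cases b <;> simp [bMatrix, hk]

lemma rowElement_eq (t x : ℂ) {M : ℕ} {lam : PartState} (hlam : ∀ i ≥ M, lam i = 0)
    (mu : PartState) (a : Fin 2) :
    rowElement t 0 0 x a (0, 0, lam) (0, 0, mu) =
      monodromy t x M a 1 (Finsupp.single mu 1) lam := by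
  rw [← siteProd_cutoff t x hlam a, rowElement, bMatrix_zero_zero, one_mul, one_mul]
  rfl

lemma rowElement_eq_zero (t x : ℂ) (a : Fin 2) {lam : LatticeState} (mu : PartState)
    (h : ¬ (lam.1 = 0 ∧ lam.2.1 = 0)) : rowElement t 0 0 x a lam (0, 0, mu) = 0 := by
  rw [rowElement]
  by_cases h1 : lam.1 = 0
  · have h2 : lam.2.1 ≠ 0 := fun h2 => h ⟨h1, h2⟩
    rw [bMatrix_succ_zero t x h2, mul_zero, zero_mul, Matrix.zero_apply]
  · rw [bMatrix_succ_zero t x h1, zero_mul, zero_mul, Matrix.zero_apply]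

/-! ### Double rows -/

/-- The embedding of the states without particles on the boundary sites. -/
def bulkState : PartState ↪ LatticeState :=
  ⟨fun lam => (0, 0, lam), fun _ _ h => by simpa using h⟩

lemma bulkState_apply (lam : PartState) : bulkState lam = (0, 0, lam) := rfl

lemma exists_bulkState_eq {lam : LatticeState} (h : lam.1 = 0 ∧ lam.2.1 = 0) :
    ∃ mu, lam = bulkState mu := ⟨lam.2.2, Prod.ext h.1 (Prod.ext h.2 rfl)⟩

lemma finsum_bulkState (F : LatticeState → ℂ) (G : PartState → ℂ) (s : Finset PartState)
    (hF : ∀ lam, ¬ (lam.1 = 0 ∧ lam.2.1 = 0) → F lam = 0) (hG : ∀ lam, F (bulkState lam) = G lam)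
    (hs : ∀ lam ∉ s, G lam = 0) : ∑ᶠ lam, F lam = ∑ lam ∈ s, G lam := by
  rw [finsum_eq_sum_of_support_subset F (s := s.map bulkState), Finset.sum_map]
  · simp only [hG]
  · intro lam hlam
    by_cases h : lam.1 = 0 ∧ lam.2.1 = 0
    · obtain ⟨mu, rfl⟩ := exists_bulkState_eq h
      rw [Finset.coe_map, Set.mem_image]
      refine ⟨mu, ?_, rfl⟩
      by_contra hmu
      exact hlam (by rw [hG, hs mu hmu])
    · exact absurd (hF lam h) hlam

/-- The operator of two rows joined by a U-turn; the upper row has the parameter `x`, the lower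
row the parameter `y`. -/
def doubleRow (t y x : ℂ) (M : ℕ) : Module.End ℂ Fock :=
  ∑ a : Fin 2, ∑ b : Fin 2, uTurn t a b • (monodromy t y M b 1 * monodromy t x M a 1)

lemma apply_apply_eq_sum (A : Module.End ℂ Fock) {f : Fock} {s : Finset PartState}
    (h : f.support ⊆ s) (lam : PartState) :
    A f lam = ∑ mu ∈ s, f mu * A (Finsupp.single mu 1) lam := by
  rw [apply_eq_sum, Finsupp.sum_of_support_subset f h _ (by simp), Finsupp.finsetSum_apply]
  simp only [Finsupp.smul_apply, smul_eq_mul]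

lemma doubleRow_apply (t y x : ℂ) (M : ℕ) (f : Fock) (lam : PartState) :
    doubleRow t y x M f lam = ∑ a : Fin 2, ∑ b : Fin 2,
      uTurn t a b * monodromy t y M b 1 (monodromy t x M a 1 f) lam := by
  simp [doubleRow, Fin.sum_univ_two]

lemma doubleRowElement_eq (t x : ℂ) {M : ℕ} {lam : PartState} (hlam : ∀ i ≥ M, lam i = 0)
    (mu : PartState) :
    doubleRowElement t 0 0 x (0, 0, lam) (0, 0, mu) =
      doubleRow t x⁻¹ x M (Finsupp.single mu 1) lam := by
  classical
  set s := Finset.univ.biUnion fun a => (monodromy t x M a 1 (Finsupp.single mu 1)).support with hs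
  rw [doubleRowElement, finsum_bulkState _ (fun nu => ∑ a : Fin 2, ∑ b : Fin 2, uTurn t a b *
    (monodromy t x M a 1 (Finsupp.single mu 1) nu *
      monodromy t x⁻¹ M b 1 (Finsupp.single nu 1) lam)) s, doubleRow_apply, Finset.sum_comm]
  · refine Finset.sum_congr rfl fun a _ => ?_
    rw [Finset.sum_comm]
    refine Finset.sum_congr rfl fun b _ => ?_
    rw [← Finset.mul_sum, apply_apply_eq_sum (f := monodromy t x M a 1 (Finsupp.single mu 1)) (s := s)]
    exact Finset.subset_biUnion_of_mem
      (fun a => (monodromy t x M a 1 (Finsupp.single mu 1)).support) (Finset.mem_univ a)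
  · intro nu hnu
    refine Finset.sum_eq_zero fun a _ => Finset.sum_eq_zero fun b _ => ?_
    rw [rowElement_eq_zero t x a mu hnu, mul_zero]
  · intro nu
    refine Finset.sum_congr rfl fun a _ => Finset.sum_congr rfl fun b _ => ?_
    rw [bulkState_apply, rowElement_eq t _ hlam]
    by_cases h0 : monodromy t x⁻¹ M b 1 (Finsupp.single nu 1) lam = 0
    · simp [h0]
    -- A nonzero lower row forces `nu` to agree with `lam` from site M on, so the upper row may be
    -- truncated at M as well.
    · rw [rowElement_eq (M := M) t x (fun i hi => by
        rw [← eq_of_monodromy_single_apply_ne_zero h0 hi, hlam i hi])]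
      ring
  · intro nu hnu
    refine Finset.sum_eq_zero fun a _ => Finset.sum_eq_zero fun b _ => ?_
    have : monodromy t x M a 1 (Finsupp.single mu 1) nu = 0 := by
      by_contra h
      exact hnu (Finset.mem_biUnion.2 ⟨a, Finset.mem_univ a, Finsupp.mem_support_iff.2 h⟩)
    rw [this, zero_mul, mul_zero]

lemma doubleRowElement_eq_zero (t x : ℂ) {lam : LatticeState} (h : ¬ (lam.1 = 0 ∧ lam.2.1 = 0))
    (mu : PartState) : doubleRowElement t 0 0 x lam (0, 0, mu) = 0 := by
  rw [doubleRowElement]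
  refine finsum_eq_zero_of_forall_eq_zero fun nu => ?_
  refine Finset.sum_eq_zero fun a _ => Finset.sum_eq_zero fun b _ => ?_
  by_cases hnu : nu.1 = 0 ∧ nu.2.1 = 0
  · obtain ⟨nu', rfl⟩ := exists_bulkState_eq hnu
    rw [bulkState_apply, rowElement_eq_zero t x⁻¹ b nu' h, mul_zero, zero_mul]
  · rw [rowElement_eq_zero t x a mu hnu, mul_zero]

lemma eq_of_doubleRow_single_apply_ne_zero {t y x : ℂ} {M : ℕ} {lam mu : PartState}
    (h : doubleRow t y x M (Finsupp.single mu 1) lam ≠ 0) {i : ℕ} (hi : M ≤ i) :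
    lam i = mu i := by
  rw [doubleRow_apply] at h
  obtain ⟨a, -, h⟩ := Finset.exists_ne_zero_of_sum_ne_zero h
  obtain ⟨b, -, h⟩ := Finset.exists_ne_zero_of_sum_ne_zero h
  obtain ⟨nu, hnu, hlam⟩ := exists_of_mem_support_apply
    (Finsupp.mem_support_iff.2 (right_ne_zero_of_mul h))
  rw [eq_of_monodromy_single_apply_ne_zero (Finsupp.mem_support_iff.1 hlam) hi,
    eq_of_monodromy_single_apply_ne_zero (Finsupp.mem_support_iff.1 hnu) hi]

/-- The state obtained from the vacuum by `m` double rows on `M` sites. -/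
def doubleRowState (t : ℂ) (M : ℕ) : (m : ℕ) → (Fin (2 * m) → ℂ) → Fock
  | 0, _ => vacuum
  | m + 1, v => doubleRow t (v (Fin.last (2 * m + 1))) (v (Fin.last (2 * m)).castSucc) M
      (doubleRowState t M m fun i => v i.castSucc.castSucc)

lemma lineParameter_last {m : ℕ} (x : Fin (m + 1) → ℂ) :
    lineParameter x (Fin.last (2 * m + 1)) = (x (Fin.last m))⁻¹ := by
  have h1 : (2 * m + 1) % 2 ≠ 0 := by omega
  have h2 : (2 * m + 1) / 2 = m := by omega
  simp only [lineParameter, Fin.val_last, h1, if_false, h2]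
  rfl

lemma lineParameter_castSucc_last {m : ℕ} (x : Fin (m + 1) → ℂ) :
    lineParameter x (Fin.last (2 * m)).castSucc = x (Fin.last m) := by
  have h1 : (2 * m) % 2 = 0 := by omega
  have h2 : (2 * m) / 2 = m := by omega
  simp only [lineParameter, Fin.val_castSucc, Fin.val_last, h1, if_true, h2]
  rfl

lemma latticeElement_eq (t : ℂ) {m : ℕ} (x : Fin m → ℂ) :
    (∀ lam : LatticeState, ¬ (lam.1 = 0 ∧ lam.2.1 = 0) → latticeElement t 0 0 m x lam = 0) ∧
    ∀ (M : ℕ) (lam : PartState), (∀ i ≥ M, lam i = 0) →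
      latticeElement t 0 0 m x (0, 0, lam) = doubleRowState t M m (lineParameter x) lam := by
  induction m with
  | zero =>
    refine ⟨fun lam h => if_neg fun h0 => h (by simp [h0]), fun M lam _ => ?_⟩
    simp [latticeElement, doubleRowState, vacuum, Finsupp.single_apply, eq_comm]
  | succ m ih =>
    obtain ⟨ih0, ih⟩ := ih fun i => x i.castSucc
    refine ⟨fun lam h => ?_, fun M lam hlam => ?_⟩
    · rw [latticeElement]
      refine finsum_eq_zero_of_forall_eq_zero fun mu => ?_
      by_cases hmu : mu.1 = 0 ∧ mu.2.1 = 0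
      · obtain ⟨mu', rfl⟩ := exists_bulkState_eq hmu
        rw [bulkState_apply, doubleRowElement_eq_zero t _ h, zero_mul]
      · rw [ih0 mu hmu, mul_zero]
    · have hv : (fun i : Fin (2 * m) => lineParameter x i.castSucc.castSucc) =
          lineParameter fun i => x i.castSucc := rfl
      set f := doubleRowState t M m (lineParameter fun i => x i.castSucc)
      have hstate : doubleRowState t M (m + 1) (lineParameter x) =
          doubleRow t (x (Fin.last m))⁻¹ (x (Fin.last m)) M f := by
        rw [doubleRowState, lineParameter_last, lineParameter_castSucc_last, hv]
      rw [hstate, apply_apply_eq_sum _ (Finset.Subset.refl _), latticeElement]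
      refine finsum_bulkState _ _ _ (fun mu hmu => by rw [ih0 mu hmu, mul_zero]) (fun mu => ?_)
        fun mu hmu => by rw [Finsupp.notMem_support_iff.1 hmu, zero_mul]
      rw [bulkState_apply, doubleRowElement_eq t _ hlam]
      by_cases h0 : doubleRow t (x (Fin.last m))⁻¹ (x (Fin.last m)) M (Finsupp.single mu 1) lam = 0
      · rw [h0, zero_mul, mul_zero]
      · rw [ih M mu fun i hi => by rw [← eq_of_doubleRow_single_apply_ne_zero h0 hi, hlam i hi],
          mul_comm]

/-! ### Homogeneity -/

lemma continuous_monodromy_single_apply (t x : ℂ) (M : ℕ) (a b : Fin 2) (lam mu : PartState) :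
    Continuous fun q => monodromy t (q * x) M a b (Finsupp.single mu 1) lam := by
  induction M generalizing b mu with
  | zero => simpa only [monodromy] using continuous_const
  | succ M ih =>
    obtain rfl | rfl : b = 0 ∨ b = 1 := by fin_cases b <;> simp
    · simp only [monodromy_zero_succ_single, Finsupp.add_apply, Finsupp.smul_apply, smul_eq_mul]
      exact ((continuous_id.mul_const x).mul (ih _ _)).add ((ih _ _).const_mul _)
    · simp only [monodromy_one_succ_single, Finsupp.add_apply, Finsupp.smul_apply, smul_eq_mul]
      exact ((continuous_id.mul_const x).mul (ih _ _)).add (ih _ _)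

/-- Each hole to the left of a site gives one factor x, and counting holes by the sites where they
start and end expresses the degree through the change of weight. The powers are distributed over
both sides to avoid negative exponents. -/
lemma monodromy_homogeneous_of_ne_zero (t x : ℂ) {q : ℂ} (hq : q ≠ 0) (M : ℕ) (a : Fin 2)
    (lam mu : PartState) :
    q ^ (weight mu + 1) * monodromy t (q * x) M a 0 (Finsupp.single mu 1) lam =
      q ^ (weight lam + M + (1 - a.val)) * monodromy t x M a 0 (Finsupp.single mu 1) lam ∧
    q ^ weight mu * monodromy t (q * x) M a 1 (Finsupp.single mu 1) lam =
      q ^ (weight lam + (1 - a.val)) * monodromy t x M a 1 (Finsupp.single mu 1) lam := by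
  induction M generalizing mu with
  | zero =>
    by_cases h : mu = lam
    · subst h
      obtain rfl | rfl : a = 0 ∨ a = 1 := by fin_cases a <;> simp
      all_goals simp [monodromy]
    · obtain rfl | rfl : a = 0 ∨ a = 1 := by fin_cases a <;> simp
      all_goals simp [monodromy, h]
  | succ M ih =>
    constructor
    · simp only [monodromy_zero_succ_single, Finsupp.add_apply, Finsupp.smul_apply, smul_eq_mul]
      have h0 := (ih mu).1
      by_cases hm : mu M = 0
      · simp only [hm, pow_zero, sub_self, zero_mul, add_zero]
        linear_combination q * x * h0
      · have h1 := (ih (mu - Finsupp.single M 1)).2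
        rw [← weight_sub_single hm] at h0 ⊢
        linear_combination q * x * h0 + q ^ (M + 1) * (1 - t ^ mu M) * h1
    · simp only [monodromy_one_succ_single, Finsupp.add_apply, Finsupp.smul_apply, smul_eq_mul]
      have h0 := (ih (mu + Finsupp.single M 1)).1
      have h1 := (ih mu).2
      rw [weight_add, weight_single, mul_one] at h0
      -- Creation at site M raises the weight by M, so the induction hypothesis carries a surplus
      -- q^M that has to be cancelled; this is where q ≠ 0 enters.
      have hqM : q ^ M ≠ 0 := pow_ne_zero M hq
      refine mul_left_cancel₀ hqM ?_
      linear_combination x * h0 + q ^ M * h1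

lemma monodromy_homogeneous (t x q : ℂ) (M : ℕ) (a : Fin 2) (lam mu : PartState) :
    q ^ weight mu * monodromy t (q * x) M a 1 (Finsupp.single mu 1) lam =
      q ^ (weight lam + (1 - a.val)) * monodromy t x M a 1 (Finsupp.single mu 1) lam := by
  -- Both sides are continuous in q, which recovers q = 0 and hence the case z = 0.
  have h := Continuous.ext_on (dense_compl_singleton (0 : ℂ))
    ((continuous_pow (weight mu)).mul (continuous_monodromy_single_apply t x M a 1 lam mu))
    ((continuous_pow (weight lam + (1 - a.val))).mul_const
      (monodromy t x M a 1 (Finsupp.single mu 1) lam))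
    fun q hq => (monodromy_homogeneous_of_ne_zero t x hq M a lam mu).2
  exact congrFun h q

lemma monodromy_apply_homogeneous (t x q : ℂ) (M : ℕ) (a : Fin 2) {k : ℕ} {f g : Fock}
    (h : ∀ mu, g mu = q ^ (weight mu + k) * f mu) (lam : PartState) :
    monodromy t (q * x) M a 1 g lam =
      q ^ (weight lam + (k + (1 - a.val))) * monodromy t x M a 1 f lam := by
  classical
  rw [apply_apply_eq_sum _ (Finset.subset_union_left (s₁ := g.support) (s₂ := f.support)),
    apply_apply_eq_sum _ (Finset.subset_union_right (s₁ := g.support) (s₂ := f.support)),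
    Finset.mul_sum]
  refine Finset.sum_congr rfl fun mu _ => ?_
  rw [h mu]
  linear_combination q ^ k * f mu * monodromy_homogeneous t x q M a lam mu

lemma uTurn_eq_zero {t : ℂ} {a b : Fin 2} (h : a.val + b.val ≠ 1) : uTurn t a b = 0 := by
  fin_cases a <;> fin_cases b <;> simp_all [uTurn]

/-- A U-turn has exactly one hole among its two ends, so each double row adds exactly one power of q
to the weight. -/
lemma doubleRowState_homogeneous (t q : ℂ) (M : ℕ) {m : ℕ} (v : Fin (2 * m) → ℂ)
    (lam : PartState) :
    doubleRowState t M m (fun j => q * v j) lam =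
      q ^ (weight lam + m) * doubleRowState t M m v lam := by
  induction m generalizing lam with
  | zero =>
    by_cases h : lam = 0
    · simp [doubleRowState, h, weight]
    · simp [doubleRowState, vacuum, Ne.symm h]
  | succ m ih =>
    rw [doubleRowState, doubleRowState, doubleRow_apply, doubleRow_apply, Finset.mul_sum]
    refine Finset.sum_congr rfl fun a _ => ?_
    rw [Finset.mul_sum]
    refine Finset.sum_congr rfl fun b _ => ?_
    by_cases hab : a.val + b.val = 1
    · rw [monodromy_apply_homogeneous t _ q M b (fun mu =>
        monodromy_apply_homogeneous t _ q M a (fun nu => ih _ nu) mu)]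
      rw [show m + (1 - a.val) + (1 - b.val) = m + 1 by omega]
      ring
    · rw [uTurn_eq_zero hab]
      ring

/-! ### Expansion of double rows into rows -/

lemma doubleRowState_eq_sum (t : ℂ) (M : ℕ) {m : ℕ} (v : Fin (2 * m) → ℂ) :
    doubleRowState t M m v = ∑ a : Fin (2 * m) → Fin 2,
      (∏ i : Fin m, uTurn t (a ⟨2 * (i : ℕ), by omega⟩) (a ⟨2 * (i : ℕ) + 1, by omega⟩)) •
        rowState t M (2 * m) v a := by
  induction m with
  | zero => simp [doubleRowState, rowState]
  | succ m ih =>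
    have hsum : ∀ F : (Fin (2 * (m + 1)) → Fin 2) → Fock, ∑ a, F a =
        ∑ b : Fin 2, ∑ a : Fin 2, ∑ c : Fin (2 * m) → Fin 2,
          F (Fin.snoc (α := fun _ => Fin 2) (Fin.snoc (α := fun _ => Fin 2) c a : Fin (2 * m + 1) → Fin 2) b :
            Fin (2 * m + 1 + 1) → Fin 2) := fun F => by
      rw [show ∑ a, F a = ∑ a : Fin (2 * m + 1 + 1) → Fin 2, F a from rfl, sum_snoc]
      exact Finset.sum_congr rfl fun b _ => sum_snoc _
    rw [hsum, doubleRowState, ih, doubleRow]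
    simp only [LinearMap.sum_apply, LinearMap.smul_apply, Module.End.mul_apply, map_sum, map_smul,
      Finset.smul_sum, smul_smul]
    have hswap : ∀ F : (Fin (2 * m) → Fin 2) → Fin 2 → Fin 2 → Fock,
        ∑ c, ∑ a, ∑ b, F c a b = ∑ b, ∑ a, ∑ c, F c a b := fun F =>
      Finset.sum_comm.trans ((Finset.sum_congr rfl fun a _ => Finset.sum_comm).trans Finset.sum_comm)
    rw [hswap]
    refine Finset.sum_congr rfl fun b _ => Finset.sum_congr rfl fun a _ =>
      Finset.sum_congr rfl fun c _ => ?_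
    have hval : ∀ j : Fin (2 * m), (Fin.snoc (α := fun _ => Fin 2)
        (Fin.snoc (α := fun _ => Fin 2) c a : Fin (2 * m + 1) → Fin 2) b :
          Fin (2 * m + 1 + 1) → Fin 2) j.castSucc.castSucc = c j := fun j => by
      rw [Fin.snoc_castSucc, Fin.snoc_castSucc]
    have hlast : (Fin.snoc (α := fun _ => Fin 2)
        (Fin.snoc (α := fun _ => Fin 2) c a : Fin (2 * m + 1) → Fin 2) b :
          Fin (2 * m + 1 + 1) → Fin 2) (Fin.last (2 * m + 1)) = b := Fin.snoc_last _ _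
    have hprev : (Fin.snoc (α := fun _ => Fin 2)
        (Fin.snoc (α := fun _ => Fin 2) c a : Fin (2 * m + 1) → Fin 2) b :
          Fin (2 * m + 1 + 1) → Fin 2) (Fin.last (2 * m)).castSucc = a := by
      rw [Fin.snoc_castSucc, Fin.snoc_last]
    generalize (Fin.snoc (α := fun _ => Fin 2)
        (Fin.snoc (α := fun _ => Fin 2) c a : Fin (2 * m + 1) → Fin 2) b :
          Fin (2 * m + 1 + 1) → Fin 2) = e at hval hlast hprev ⊢
    rw [Fin.prod_univ_castSucc]
    congr 1
    · congr 1
      · refine Finset.prod_congr rfl fun i _ => ?_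
        rw [← hval, ← hval]
        rfl
      · rw [← hprev, ← hlast]
        rfl
    · rw [← hlast, ← hprev, show c = fun j => e j.castSucc.castSucc from funext fun j => (hval j).symm]
      rfl

lemma doubleRowState_numParts (t : ℂ) (M : ℕ) {m : ℕ} (v : Fin (2 * m) → ℂ) {lam : PartState}
    (h : doubleRowState t M m v lam ≠ 0) : numParts lam = m := by
  induction m generalizing lam with
  | zero =>
    have : lam = 0 := by
      by_contra h0
      exact h (by simp [doubleRowState, vacuum, Ne.symm h0])
    simp [this, numParts]
  | succ m ih =>
    rw [doubleRowState, doubleRow_apply] at h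
    obtain ⟨a, -, h⟩ := Finset.exists_ne_zero_of_sum_ne_zero h
    obtain ⟨b, -, h⟩ := Finset.exists_ne_zero_of_sum_ne_zero h
    obtain ⟨nu, hnu, hlam⟩ := exists_of_mem_support_apply
      (Finsupp.mem_support_iff.2 (right_ne_zero_of_mul h))
    obtain ⟨mu, hmu, hnu⟩ := exists_of_mem_support_apply hnu
    have h1 := shifts_monodromy _ _ _ _ _ _ _ hlam
    have h2 := shifts_monodromy _ _ _ _ _ _ _ hnu
    have h3 := ih _ (Finsupp.mem_support_iff.1 hmu)
    have hab : a.val + b.val = 1 := by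
      by_contra hab
      exact left_ne_zero_of_mul h (uTurn_eq_zero hab)
    simp only [Fin.val_one] at h1 h2
    omega

/-- Starting from the vacuum, operators on M sites cannot create a part of size at least M. In the
dominated convergence this covers the terms not yet reached by the truncation. -/
lemma doubleRowState_eq_zero (t : ℂ) {M m : ℕ} (v : Fin (2 * m) → ℂ) {lam : PartState} {i : ℕ}
    (hi : M ≤ i) (hlam : lam i ≠ 0) : doubleRowState t M m v lam = 0 := by
  induction m generalizing lam with
  | zero =>
    have : lam ≠ 0 := fun h => hlam (by simp [h])
    simp [doubleRowState, vacuum, this.symm]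
  | succ m ih =>
    by_contra h
    rw [doubleRowState] at h
    obtain ⟨mu, hmu, h⟩ := exists_of_mem_support_apply (Finsupp.mem_support_iff.2 h)
    refine Finsupp.mem_support_iff.1 hmu (ih _ ?_)
    rwa [← eq_of_doubleRow_single_apply_ne_zero (Finsupp.mem_support_iff.1 h) hi]

lemma tendsto_evenCovector_doubleRowState (t : ℂ) {m : ℕ} {v : Fin (2 * m) → ℂ}
    (hv : ∀ i, ‖v i‖ < 1) :
    Tendsto (fun M => evenCovector t (doubleRowState t M m v)) atTop
      (𝓝 (∑ a : Fin (2 * m) → Fin 2,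
        (∏ i : Fin m, uTurn t (a ⟨2 * (i : ℕ), by omega⟩) (a ⟨2 * (i : ℕ) + 1, by omega⟩)) *
          rowLimit t (2 * m) v a)) := by
  simp only [doubleRowState_eq_sum, map_sum, map_smul, smul_eq_mul]
  exact tendsto_finsetSum _ fun a _ => (tendsto_evenCovector_rowState t hv a).const_mul _

lemma exists_fockNorm_doubleRowState_le (t : ℂ) {m : ℕ} {v : Fin (2 * m) → ℂ}
    (hv : ∀ i, ‖v i‖ < 1) : ∃ K : ℝ, ∀ M, fockNorm 1 (doubleRowState t M m v) ≤ K := by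
  choose n K hK using fun a => boundedSeq_rowState t (r := 1) le_rfl (v := v) (by simpa using hv) a
  refine ⟨∑ a : Fin (2 * m) → Fin 2,
    ‖∏ i : Fin m, uTurn t (a ⟨2 * (i : ℕ), by omega⟩) (a ⟨2 * (i : ℕ) + 1, by omega⟩)‖ * K a,
    fun M => ?_⟩
  rw [doubleRowState_eq_sum]
  refine (fockNorm_sum_le zero_le_one _ _).trans (Finset.sum_le_sum fun a _ => ?_)
  rw [fockNorm_smul]
  exact mul_le_mul_of_nonneg_left (hK a M).2 (norm_nonneg _)

/-! ### The sum over even partitions -/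

lemma sum_norm_le_fockNorm (f : Fock) (s : Finset PartState) :
    ∑ lam ∈ s, ‖f lam‖ ≤ fockNorm 1 f := by
  classical
  rw [fockNorm_eq_sum (Finset.subset_union_right (s₁ := s) (s₂ := f.support))]
  simp only [one_pow, one_mul]
  exact Finset.sum_le_sum_of_subset_of_nonneg Finset.subset_union_left fun _ _ _ => norm_nonneg _

lemma evenCovector_eq_tsum (t : ℂ) {f : Fock} {m : ℕ} (hf : ∀ lam, f lam ≠ 0 → numParts lam = m) :
    evenCovector t f = ∑' lam : EvenPartition m, evenCoeff t lam.1 * f lam.1 := by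
  classical
  rw [tsum_eq_sum (s := f.support.subtype fun lam => numParts lam = m ∧ ∀ i, Even (lam i))
    fun lam hlam => by
      rw [Finset.mem_subtype, Finsupp.notMem_support_iff] at hlam
      rw [hlam, mul_zero]]
  rw [Finset.sum_subtype_eq_sum_filter (f := fun lam => evenCoeff t lam * f lam), Finset.sum_filter,
    evenCovector, Finsupp.linearCombination_apply, Finsupp.sum]
  refine Finset.sum_congr rfl fun lam hlam => ?_
  rw [smul_eq_mul]
  by_cases h : ∀ i, Even (lam i)
  · rw [if_pos h, if_pos ⟨hf lam (Finsupp.mem_support_iff.1 hlam), h⟩, mul_comm]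
  · rw [if_neg h, if_neg fun h' => h h'.2, mul_zero]

lemma exists_forall_ge_eq_zero (lam : PartState) : ∃ M, ∀ i ≥ M, lam i = 0 :=
  ⟨cutoff lam lam, fun _ hi => (eq_zero_of_cutoff_le hi).1⟩

lemma even_weight {lam : PartState} (h : ∀ i, Even (lam i)) : Even (weight lam) :=
  Finset.even_sum _ fun i _ => (h i).mul_left i

end ReflectingLittlewood

end

open ReflectingLittlewood Filter Topology in
theorem mainTheorem5 (n : ℕ) (x : Fin (2 * n) → ℂ) (t z : ℂ)
    (hx : ∀ i, x i ≠ 0) (hxt : ∀ i, x i ≠ t * (x i)⁻¹)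
    (hz : ∀ i, ‖z‖ * ‖x i‖ ^ 2 < 1 ∧ ‖z‖ * ‖(x i)⁻¹‖ ^ 2 < 1) :
    (Summable fun lam : ReflectingLittlewood.EvenPartition (2 * n) =>
      z ^ (n + ReflectingLittlewood.weight lam.1 / 2) *
        ReflectingLittlewood.evenCoeff t lam.1 *
        ReflectingLittlewood.hallLittlewoodK t 0 0 x lam.1) ∧
    (∏ j, (x j - t * (x j)⁻¹)) *
      ∑' lam : ReflectingLittlewood.EvenPartition (2 * n),
        z ^ (n + ReflectingLittlewood.weight lam.1 / 2) *
          ReflectingLittlewood.evenCoeff t lam.1 *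
          ReflectingLittlewood.hallLittlewoodK t 0 0 x lam.1 =
      ReflectingLittlewood.partitionFunctionUO t z x := by
  obtain ⟨q, rfl⟩ : ∃ q : ℂ, z = q ^ 2 := ⟨z ^ (2⁻¹ : ℂ), by
    rw [← Complex.cpow_nat_mul]; simp⟩
  have hP : ∏ j, (x j - t * (x j)⁻¹) ≠ 0 :=
    Finset.prod_ne_zero_iff.2 fun j _ => sub_ne_zero.2 (hxt j)
  set P := ∏ j, (x j - t * (x j)⁻¹) with hPdef
  set v : Fin (2 * (2 * n)) → ℂ := fun j => q * lineParameter x j with hvdef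
  have hv : ∀ j, ‖v j‖ < 1 := fun j => by
    have hsq : ∀ y : ℂ, ‖q ^ 2‖ * ‖y‖ ^ 2 < 1 → ‖q * y‖ < 1 := fun y hy => by
      rw [norm_pow, ← mul_pow, ← norm_mul] at hy
      exact (sq_lt_one_iff₀ (norm_nonneg _)).1 hy
    simp only [hvdef, lineParameter]
    split_ifs
    · exact hsq _ (hz _).1
    · exact hsq _ (hz _).2
  set F : EvenPartition (2 * n) → ℂ := fun lam =>
    (q ^ 2) ^ (n + weight lam.1 / 2) * evenCoeff t lam.1 * hallLittlewoodK t 0 0 x lam.1 with hF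
  -- Even multiplicities make the weight even, so q^(|λ| + 2n) is the integral power z^(n + |λ|/2).
  have key : ∀ (M : ℕ) (lam : EvenPartition (2 * n)), (∀ i ≥ M, lam.1 i = 0) →
      evenCoeff t lam.1 * doubleRowState t M (2 * n) v lam.1 = P * F lam := by
    intro M lam hlam
    obtain ⟨k, hk⟩ := even_weight lam.2.2
    rw [doubleRowState_homogeneous, ← (latticeElement_eq t x).2 M lam.1 hlam, hF]
    simp only [hallLittlewoodK]
    rw [← hPdef, ← pow_mul, hk, show 2 * (n + (k + k) / 2) = k + k + 2 * n by omega]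
    field_simp
  obtain ⟨K, hK⟩ := exists_fockNorm_doubleRowState_le t hv
  -- For a finite set of partitions some M exceeds all their parts, so a partial sum is bounded by
  -- the norm of one truncated state, and that bound does not depend on M.
  have hsum : Summable fun lam => ‖P * F lam‖ := by
    refine summable_of_sum_le (c := ((1 + ‖t‖) ^ (2 * n)) ^ (2 * n) * K)
      (fun _ => norm_nonneg _) fun u => ?_
    choose N hN using fun lam : EvenPartition (2 * n) => exists_forall_ge_eq_zero lam.1
    have hM : ∀ lam ∈ u, ∀ i ≥ u.sup N, lam.1 i = 0 := fun lam hl i hi =>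
      hN lam i ((Finset.le_sup hl).trans hi)
    calc ∑ lam ∈ u, ‖P * F lam‖ ≤ ∑ lam ∈ u, ((1 + ‖t‖) ^ (2 * n)) ^ (2 * n) *
          ‖doubleRowState t (u.sup N) (2 * n) v lam.1‖ := Finset.sum_le_sum fun lam hl => by
            rw [← key _ lam (hM lam hl), norm_mul]
            gcongr
            exact norm_evenCoeff_le t lam.2.1.le
      _ = ((1 + ‖t‖) ^ (2 * n)) ^ (2 * n) * ∑ lam ∈ u.map (Function.Embedding.subtype _),
          ‖doubleRowState t (u.sup N) (2 * n) v lam‖ := by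
            rw [Finset.sum_map, Finset.mul_sum]
            rfl
      _ ≤ _ := by
            gcongr
            exact (sum_norm_le_fockNorm _ _).trans (hK _)
  have hFsum : Summable F := (summable_mul_left_iff hP).1 hsum.of_norm
  refine ⟨hFsum, ?_⟩
  rw [← tsum_mul_left, partitionFunctionUO_eq_sum]
  have hE : ∀ M, evenCovector t (doubleRowState t M (2 * n) v) =
      ∑' lam : EvenPartition (2 * n), evenCoeff t lam.1 * doubleRowState t M (2 * n) v lam.1 :=
    fun M => evenCovector_eq_tsum t fun _ => doubleRowState_numParts t M v
  refine tendsto_nhds_unique ?_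
    ((tendsto_evenCovector_doubleRowState t hv).congr hE)
  -- Each truncated term equals its limit or is zero, so the limiting series is its own dominating
  -- series.
  refine tendsto_tsum_of_dominated_convergence hsum (fun lam => ?_)
    (Eventually.of_forall fun M lam => ?_)
  · obtain ⟨N, hN⟩ := exists_forall_ge_eq_zero lam.1
    refine tendsto_const_nhds.congr' ?_
    filter_upwards [eventually_ge_atTop N] with M hM
    exact (key M lam fun i hi => hN i (hM.trans hi)).symm
  · by_cases h : ∀ i ≥ M, lam.1 i = 0
    · exact (congrArg norm (key M lam h)).le
    · push Not at h
      obtain ⟨i, hi, hne⟩ := h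
      rw [doubleRowState_eq_zero t v hi hne, mul_zero, norm_zero]
      exact norm_nonneg _
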